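/- (ZFC.) There is a proper, $\aleph_0$-distributive complete Boolean algebra of density $2^{\omega}$ for which player II has no winning strategy in the cut-and-choose game. More precisely: Let $\mathcal T$ be the class of trees $T$ whose underlying set is a countable set of countable ordinals and such that for every $x\in T$ and every $\gamma<\mathrm{height}(T)$ some node on the $\gamma$-th level of $T$ is comparable with or equal to $x$. For an ordinal $\beta$ let $T\restriction\beta$ be the set of nodes of $T$ on levels below $\beta$, with the inherited order. Call $f:\mathcal T\to\mathcal T$ a mandatory extension function if $\mathrm{height}(f(T))=\mathrm{height}(T)+1$ and $T=f(T)\restriction\mathrm{height}(T)$ for all $T\in\mathcal T$. For $S\subseteq\omega_1$ and such an $f$ let $$Q_0=\{T\in\mathcal T:\ \forall\beta\in S\cap\mathrm{height}(T)\quad T\restriction(\beta+1)=f(T\restriction\beta)\},$$ ordered by $T_0\le T_1$ iff $T_1=T_0\restriction\mathrm{height}(T_1)$; let $\dot Q_1$ be the $Q_0$-name for the generic tree $\bigcup G$, regarded as a forcing notion in which nodes higher in the tree are stronger; let $P=Q_0*\dot Q_1$ be the two-step iteration and $B=RO(P)$ its regular open algebra. There exist a stationary set $S\subseteq\omega_1$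 with stationary complement and a mandatory extension function $f$. For all such $S$ and $f$: 1. $Q_0$ is $\sigma$-closed, and $Q_0\Vdash$ "$\bigcup G$ is a Souslin tree"; 2. $B$ is proper: for every uncountable set $X$, every stationary subset of $[X]^{\omega}$ remains stationary in the extension by $B$; 3. $B$ is $\aleph_0$-distributive: $\bigwedge_{n<\omega}\bigvee_{i\in I}a_{n,i}=\bigvee_{g:\omega\to I}\bigwedge_{n<\omega}a_{n,g(n)}$ for every set $I$ and all $a_{n,i}\in B$; 4. the density of $B$ (the least cardinality of a dense subset) is $2^{\omega}$; 5. II has no winning strategy in the descending chain game $\mathcal G$ on $B$, in which I and II alternately play nonzero elements $b_0\ge c_0\ge b_1\ge c_1\ge\cdots$ of $B$ (I plays the $b_i$, II the $c_i$) and II wins iff $\bigwedge_{i<\omega}b_i\ne0$; 6. II has no winning strategy in the cut-and-choose game on $B$, in which I plays a nonzero $p\in B$ and elements $b_0,b_1,\dots\in B$, II answers each $b_i$ by $r_i\in\{0,1\}$ before $b_{i+1}$ is played, and II wins iff $p\wedge\bigwedge_{r_i=1}b_i-\bigvee_{r_i=0}b_i\ne0$. -/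

import Mathlib

open Cardinal Ordinal

/-! ### Complete Boolean algebras: properness, distributivity, density -/

namespace CutChoose

/-- `a` is a `B`-valued name for an element of the ground-model set `X`:
`a x` is the truth value of "`a = x`". -/
def IsElementName {B X : Type*} [CompleteBooleanAlgebra B] (a : X → B) : Prop :=
  (∀ x y, x ≠ y → a x ⊓ a y = ⊥) ∧ ⨆ x, a x = ⊤

/-- `Z` is closed under the finitary operations coded by `F` (one of each arity). -/
def ClosedUnder {X : Type*} (F : List X → X) (Z : Set X) : Prop :=
  ∀ e : List X, (∀ x ∈ e, x ∈ Z) → F e ∈ Z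

/-- A family of countable subsets of `X` is stationary in `[X]^ω` if for all finitary operations
on `X` some member of the family is closed under them. -/
def StationaryFamily {X : Type*} (𝒮 : Set (Set X)) : Prop :=
  ∀ F : List X → X, ∃ Z ∈ 𝒮, ClosedUnder F Z

/-- The Boolean truth value of "some member of `𝒮` is closed under `F`", where `F` is a name for a
function from finite sequences of elements of `X` to `X`, and `F e y` is the truth value of
"`F(e) = y`". -/
def closedMemberValue {B X : Type*} [CompleteBooleanAlgebra B] (𝒮 : Set (Set X))
    (F : List X → X → B) : B :=
  ⨆ Z ∈ 𝒮, ⨅ e : List X, ⨅ _ : ∀ x ∈ e, x ∈ Z, ⨆ y ∈ Z, F e y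

/-- `B` is proper: for every uncountable set `X`, every stationary family of countable subsets of
`X` is forced to remain stationary. -/
def IsProper.{u} (B : Type u) [CompleteBooleanAlgebra B] : Prop :=
  ∀ (X : Type u) [Uncountable X] (𝒮 : Set (Set X)), (∀ Z ∈ 𝒮, Z.Countable) →
    StationaryFamily 𝒮 →
    ∀ F : List X → X → B, (∀ e, IsElementName (F e)) → closedMemberValue 𝒮 F = ⊤

/-- `ℵ₀`-distributivity, i.e. `(ω, ∞)`-distributivity. -/
def IsAleph0Distributive.{u} (B : Type u) [CompleteBooleanAlgebra B] : Prop :=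
  ∀ (I : Type u) (a : ℕ → I → B), ⨅ n, ⨆ i, a n i = ⨆ g : ℕ → I, ⨅ n, a n (g n)

/-- `D` is a dense subset of `B`. -/
def IsDenseSubset {B : Type*} [CompleteBooleanAlgebra B] (D : Set B) : Prop :=
  (∀ d ∈ D, d ≠ ⊥) ∧ ∀ b : B, b ≠ ⊥ → ∃ d ∈ D, d ≤ b

/-- The density of `B`: the least cardinality of a dense subset. -/
noncomputable def density.{u} (B : Type u) [CompleteBooleanAlgebra B] : Cardinal.{u} :=
  sInf {κ | ∃ D : Set B, IsDenseSubset D ∧ #D = κ}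

/-! ### The two games -/

/-- The moves `b 0, …, b (n - 1)`. -/
def initialMoves {B : Type*} (b : ℕ → B) (n : ℕ) : List B := (List.range n).map b

/-- II has a winning strategy in the cut-and-choose game on `B`. Player I plays `p ≠ 0` and
`b 0`, then `b 1`, `b 2`, …; II answers `b i` by the bit `σ p [b 0, …, b i]`. -/
def IIWinsCutChoose (B : Type*) [CompleteBooleanAlgebra B] : Prop :=
  ∃ σ : B → List B → Bool, ∀ p : B, p ≠ ⊥ → ∀ b : ℕ → B,
    (p ⊓ ⨅ i, ⨅ _ : σ p (initialMoves b (i + 1)) = true, b i) \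
      (⨆ i, ⨆ _ : σ p (initialMoves b (i + 1)) = false, b i) ≠ ⊥

/-- `b 0, …, b n` are legal moves of I in the descending chain game against the strategy `τ`
of II. All moves in this game are nonzero. -/
def LegalAgainst {B : Type*} [CompleteBooleanAlgebra B] (τ : List B → B) (b : ℕ → B) (n : ℕ) :
    Prop :=
  (∀ i ≤ n, b i ≠ ⊥) ∧ ∀ i < n, b (i + 1) ≤ τ (initialMoves b (i + 1))

/-- II has a winning strategy in the descending chain game `b 0 ≥ c 0 ≥ b 1 ≥ c 1 ≥ …`, where
`c i = τ [b 0, …, b i]`: the strategy always gives legal moves, and the meet of every run is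
nonzero. -/
def IIWinsDescending (B : Type*) [CompleteBooleanAlgebra B] : Prop :=
  ∃ τ : List B → B,
    (∀ b n, LegalAgainst τ b n →
      τ (initialMoves b (n + 1)) ≠ ⊥ ∧ τ (initialMoves b (n + 1)) ≤ b n) ∧
    ∀ b, (∀ n, LegalAgainst τ b n) → ⨅ n, b n ≠ ⊥

/-! ### Regular open algebras and forcing -/

/-- The Heyting-regular elements of a frame form a complete Boolean algebra. -/
noncomputable instance regularCompleteBooleanAlgebra {α : Type*} [Order.Frame α] :
    CompleteBooleanAlgebra (Heyting.Regular α) :=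
  { (inferInstance : BooleanAlgebra (Heyting.Regular α)),
    (Heyting.Regular.gi (α := α)).liftCompleteLattice with }

/-- The regular open algebra of a forcing notion (stronger conditions are smaller): the regular
open sets of the topology whose open sets are the downward closed sets of conditions. -/
abbrev RO (P : Type*) [Preorder P] : Type _ := Heyting.Regular (LowerSet P)

/-- The condition `p` forces the statement with truth value `b`. -/
def Forces {P : Type*} [Preorder P] (p : P) (b : RO P) : Prop := p ∈ (b : LowerSet P)

/-- Every descending `ω`-sequence of conditions has a lower bound. -/
def IsSigmaClosed (P : Type*) [Preorder P] : Prop :=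
  ∀ t : ℕ → P, Antitone t → ∃ q, ∀ n, q ≤ t n

/-- A `B`-name for a preordered set with underlying set included in the ground-model set `X`. -/
structure NamedPreorder (B X : Type*) [CompleteBooleanAlgebra B] where
  mem : X → B
  le : X → X → B
  le_mem : ∀ x y, le x y ≤ mem x ⊓ mem y
  refl : ∀ x, mem x ≤ le x x
  trans : ∀ x y z, le x y ⊓ le y z ≤ le x z

/-- Conditions of the two-step iteration `Q * R`: pairs of `q ∈ Q` and a `Q`-name `x` with
`q ⊩ x ∈ R`. -/
structure TwoStep {Q X : Type*} [Preorder Q] (R : NamedPreorder (RO Q) X) where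
  fst : Q
  snd : X → RO Q
  isName : IsElementName snd
  forces_mem : Forces fst (⨆ x, snd x ⊓ R.mem x)

/-- The truth value of "`x ≤ y` in `R`" for names `x`, `y`. -/
noncomputable def NamedPreorder.nameLe {B X : Type*} [CompleteBooleanAlgebra B]
    (R : NamedPreorder B X) (a b : X → B) : B :=
  ⨆ x, ⨆ y, a x ⊓ b y ⊓ R.le x y

theorem NamedPreorder.le_nameLe_self {B X : Type*} [CompleteBooleanAlgebra B]
    (R : NamedPreorder B X) (a : X → B) : ⨆ x, a x ⊓ R.mem x ≤ R.nameLe a a :=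
  iSup_le fun x => le_trans (le_inf (le_inf inf_le_left inf_le_left)
    (inf_le_right.trans (R.refl x))) (le_iSup₂ (f := fun x y => a x ⊓ a y ⊓ R.le x y) x x)

theorem NamedPreorder.nameLe_trans {B X : Type*} [CompleteBooleanAlgebra B]
    (R : NamedPreorder B X) (a b c : X → B) (hb : ∀ x y, x ≠ y → b x ⊓ b y = ⊥) :
    R.nameLe a b ⊓ R.nameLe b c ≤ R.nameLe a c := by
  have key : ∀ x y y' z,
      (a x ⊓ b y ⊓ R.le x y) ⊓ (b y' ⊓ c z ⊓ R.le y' z) ≤ R.nameLe a c := by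
    intro x y y' z
    by_cases h : y = y'
    · subst h
      refine le_trans (b := a x ⊓ c z ⊓ R.le x z) ?_
        (le_iSup₂ (f := fun x z => a x ⊓ c z ⊓ R.le x z) x z)
      exact le_inf (le_inf (inf_le_left.trans (inf_le_left.trans inf_le_left))
        (inf_le_right.trans (inf_le_left.trans inf_le_right)))
        ((inf_le_inf inf_le_right inf_le_right).trans (R.trans x y z))
    · refine le_trans (b := b y ⊓ b y') ?_ (by rw [hb y y' h]; exact bot_le)
      exact inf_le_inf (inf_le_left.trans inf_le_right) (inf_le_left.trans inf_le_left)
  have h1 : R.nameLe a b ⊓ R.nameLe b c =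
      ⨆ x, ⨆ y, (a x ⊓ b y ⊓ R.le x y) ⊓ R.nameLe b c := by
    conv_lhs => rw [NamedPreorder.nameLe, iSup_inf_eq]
    simp only [iSup_inf_eq]
  rw [h1]
  refine iSup_le fun x => iSup_le fun y => ?_
  rw [NamedPreorder.nameLe.eq_def R b c, inf_iSup_eq]
  refine iSup_le fun y' => ?_
  rw [inf_iSup_eq]
  exact iSup_le fun z => key x y y' z

/-- `(q', x') ≤ (q, x)` iff `q' ≤ q` and `q' ⊩ x' ≤ x`. -/
instance TwoStep.instPreorder {Q X : Type*} [Preorder Q] (R : NamedPreorder (RO Q) X) :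
    Preorder (TwoStep R) where
  le p q := p.fst ≤ q.fst ∧ Forces p.fst (R.nameLe p.snd q.snd)
  le_refl p := ⟨le_rfl, R.le_nameLe_self p.snd p.forces_mem⟩
  le_trans p q r hpq hqr := ⟨hpq.1.trans hqr.1,
    R.nameLe_trans p.snd q.snd r.snd q.isName.1
      ⟨hpq.2, (R.nameLe q.snd r.snd : LowerSet Q).lower hpq.1 hqr.2⟩⟩

/-! ### Truth values for Souslin trees -/

/-- The truth value of "the set named by `A` is countable", i.e. covered by the range of some
function `ℕ → X`; here `X` is a nonempty ground-model set. -/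
noncomputable def countableValue {B X : Type*} [CompleteBooleanAlgebra B] (A : X → B) : B :=
  ⨆ g : {g : ℕ → X → B // ∀ n, IsElementName (g n)}, ⨅ x, A x ⇨ ⨆ n, g.1 n x

/-- The truth value of "`A` is a subset of the set named by `mem`". -/
noncomputable def subsetValue {B X : Type*} [CompleteBooleanAlgebra B] (mem A : X → B) : B :=
  ⨅ x, A x ⇨ mem x

/-- The truth value of "the elements of `A` are pairwise comparable". -/
noncomputable def chainValue {B X : Type*} [CompleteBooleanAlgebra B] (lt : X → X → B)
    (A : X → B) : B :=
  ⨅ x, ⨅ y, ⨅ _ : x ≠ y, (A x ⊓ A y) ⇨ (lt x y ⊔ lt y x)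

/-- The truth value of "the elements of `A` are pairwise incomparable". -/
noncomputable def antichainValue {B X : Type*} [CompleteBooleanAlgebra B] (lt : X → X → B)
    (A : X → B) : B :=
  ⨅ x, ⨅ y, ⨅ _ : x ≠ y, (A x ⊓ A y) ⇨ (lt x y ⊔ lt y x)ᶜ

/-- The truth value of "`(mem, lt)` is a tree": a strict partial order in which the set of
predecessors of every element is well-ordered. (Every nonempty subset having a minimal element
is, for a strict partial order with linearly ordered sets of predecessors, the same as
well-ordering of these.) -/
noncomputable def treeValue {B X : Type*} [CompleteBooleanAlgebra B] (mem : X → B)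
    (lt : X → X → B) : B :=
  (⨅ x, ⨅ y, lt x y ⇨ (mem x ⊓ mem y)) ⊓ (⨅ x, (lt x x)ᶜ) ⊓
  (⨅ x, ⨅ y, ⨅ z, (lt x y ⊓ lt y z) ⇨ lt x z) ⊓
  (⨅ x, ⨅ y, ⨅ z, ⨅ _ : x ≠ y, (lt x z ⊓ lt y z) ⇨ (lt x y ⊔ lt y x)) ⊓
  ⨅ A : X → B, (subsetValue mem A ⊓ ⨆ x, A x) ⇨ ⨆ x, A x ⊓ ⨅ y, (A y ⊓ lt y x)ᶜ

/-- The truth value of "`(mem, lt)` is a Souslin tree": an uncountable tree with no uncountable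
chains and no uncountable antichains. For trees on subsets of `ω₁` uncountability means
cardinality `ℵ₁`. -/
noncomputable def souslinValue {B X : Type*} [CompleteBooleanAlgebra B] (mem : X → B)
    (lt : X → X → B) : B :=
  treeValue mem lt ⊓ (countableValue mem)ᶜ ⊓
  (⨅ A : X → B, (subsetValue mem A ⊓ chainValue lt A) ⇨ countableValue A) ⊓
  ⨅ A : X → B, (subsetValue mem A ⊓ antichainValue lt A) ⇨ countableValue A

/-! ### Trees on countable ordinals and the forcing -/

/-- The set of countable ordinals, as a type in the lowest universe; it serves as the set of
possible nodes of trees. -/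
abbrev Node : Type := (ω_ 1 : Ordinal.{0}).ToType

/-- A tree whose underlying set is a countable set of countable ordinals. -/
@[ext]
structure CountableTree where
  carrier : Set Node
  lt : Node → Node → Prop
  countable : carrier.Countable
  lt_mem : ∀ {x y}, lt x y → x ∈ carrier ∧ y ∈ carrier
  trans : ∀ {x y z}, lt x y → lt y z → lt x z
  wellOrder : ∀ x, IsWellOrder {y // lt y x} (fun a b => lt a b)

namespace CountableTree

/-- The level of `x` in `T`: the order type of the set of its predecessors. -/
noncomputable def level (T : CountableTree) (x : Node) : Ordinal.{0} :=
  haveI := T.wellOrder x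
  Ordinal.type (fun a b : {y // T.lt y x} => T.lt a b)

/-- The height of `T`: the least ordinal greater than the levels of all nodes. -/
noncomputable def height (T : CountableTree) : Ordinal.{0} :=
  sInf {α | ∀ x ∈ T.carrier, T.level x < α}

/-- `T ↾ β`: the nodes on levels below `β`, with the inherited order. -/
noncomputable def restrict (T : CountableTree) (β : Ordinal.{0}) : CountableTree where
  carrier := {x ∈ T.carrier | T.level x < β}
  lt x y := T.lt x y ∧ (x ∈ T.carrier ∧ T.level x < β) ∧ (y ∈ T.carrier ∧ T.level y < β)
  countable := T.countable.mono fun _ h => h.1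
  lt_mem h := ⟨h.2.1, h.2.2⟩
  trans h h' := ⟨T.trans h.1 h'.1, h.2.1, h'.2.2⟩
  wellOrder x := by
    have := T.wellOrder x
    let e : (fun a b : {y // T.lt y x ∧ (y ∈ T.carrier ∧ T.level y < β) ∧
          (x ∈ T.carrier ∧ T.level x < β)} =>
        T.lt a b ∧ (a.1 ∈ T.carrier ∧ T.level a < β) ∧ (b.1 ∈ T.carrier ∧ T.level b < β)) ↪r
        (fun a b : {y // T.lt y x} => T.lt a b) :=
      { toFun := fun a => ⟨a.1, a.2.1⟩
        inj' := fun a b h => Subtype.ext (congrArg (fun c => c.1) h)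
        map_rel_iff' := fun {a b} => ⟨fun h => ⟨h, a.2.2.1, b.2.2.1⟩, fun h => h.1⟩ }
    exact e.isWellOrder

theorem level_lt_level (T : CountableTree) {y x : Node} (h : T.lt y x) :
    T.level y < T.level x := by
  have := T.wellOrder x
  have := T.wellOrder y
  refine Ordinal.type_lt_iff.2 ⟨⟨⟨⟨fun a => ⟨a.1, T.trans a.2 h⟩, fun a b hab => Subtype.ext
    (congrArg (fun c => c.1) hab)⟩, Iff.rfl⟩, ⟨y, h⟩, fun b => ⟨?_, fun hb => ⟨⟨b.1, hb⟩, rfl⟩⟩⟩⟩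
  rintro ⟨a, rfl⟩
  exact a.2

theorem level_lt_height (T : CountableTree) {x : Node} (hx : x ∈ T.carrier) :
    T.level x < T.height := by
  have hne : {α | ∀ x ∈ T.carrier, T.level x < α}.Nonempty :=
    ⟨(⨆ x, T.level x) + 1, fun x _ => Order.lt_succ_of_le (Ordinal.le_iSup T.level x)⟩
  exact csInf_mem hne x hx

theorem height_le (T : CountableTree) {α : Ordinal.{0}} (h : ∀ x ∈ T.carrier, T.level x < α) :
    T.height ≤ α :=
  csInf_le' h

theorem restrict_height (T : CountableTree) : T.restrict T.height = T := by
  ext x y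
  · exact ⟨fun h => h.1, fun h => ⟨h, T.level_lt_height h⟩⟩
  · exact ⟨fun h => h.1, fun h => ⟨h, ⟨(T.lt_mem h).1, T.level_lt_height (T.lt_mem h).1⟩,
      ⟨(T.lt_mem h).2, T.level_lt_height (T.lt_mem h).2⟩⟩⟩

theorem restrict_lt_iff (T : CountableTree) {β : Ordinal.{0}} {x y : Node}
    (hx : x ∈ (T.restrict β).carrier) : (T.restrict β).lt y x ↔ T.lt y x :=
  ⟨fun h => h.1, fun h => ⟨h, ⟨(T.lt_mem h).1, (T.level_lt_level h).trans hx.2⟩, hx⟩⟩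

theorem level_restrict (T : CountableTree) {β : Ordinal.{0}} {x : Node}
    (hx : x ∈ (T.restrict β).carrier) : (T.restrict β).level x = T.level x := by
  have := T.wellOrder x
  have := (T.restrict β).wellOrder x
  refine Ordinal.type_eq.2 ⟨⟨Equiv.subtypeEquivRight fun y => T.restrict_lt_iff hx, ?_⟩⟩
  rintro ⟨a, ha⟩ ⟨b, hb⟩
  exact (T.restrict_lt_iff (((T.restrict β).lt_mem hb).1)).symm

theorem height_restrict_le (T : CountableTree) (β : Ordinal.{0}) :
    (T.restrict β).height ≤ T.height :=
  height_le _ fun x hx => by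
    rw [T.level_restrict hx]
    exact T.level_lt_height hx.1

theorem restrict_restrict (T : CountableTree) {β γ : Ordinal.{0}} (h : γ ≤ β) :
    (T.restrict β).restrict γ = T.restrict γ := by
  have hc : ∀ x, x ∈ ((T.restrict β).restrict γ).carrier ↔ x ∈ (T.restrict γ).carrier := by
    intro x
    constructor
    · rintro ⟨h1, h2⟩
      rw [T.level_restrict h1] at h2
      exact ⟨h1.1, h2⟩
    · rintro ⟨h1, h2⟩
      have hx : x ∈ (T.restrict β).carrier := ⟨h1, h2.trans_le h⟩
      exact ⟨hx, by rwa [T.level_restrict hx]⟩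
  ext x y
  · exact hc x
  · constructor
    · exact fun h' => ⟨h'.1.1, (hc x).1 h'.2.1, (hc y).1 h'.2.2⟩
    · exact fun h' => ⟨(T.restrict_lt_iff ((hc y).2 h'.2.2).1).2 h'.1,
        (hc x).2 h'.2.1, (hc y).2 h'.2.2⟩

/-- Every node of `T` is comparable with (or equal to) some node on each level below the height
of `T`. -/
def Extendible (T : CountableTree) : Prop :=
  ∀ x ∈ T.carrier, ∀ γ < T.height, ∃ y ∈ T.carrier, T.level y = γ ∧ (T.lt x y ∨ x = y ∨ T.lt y x)

end CountableTree

/-- `f` assigns to every extendible tree an extendible end-extension with exactly one more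
level. -/
def IsMandatoryExtension (f : CountableTree → CountableTree) : Prop :=
  ∀ T : CountableTree, T.Extendible →
    (f T).Extendible ∧ (f T).height = T.height + 1 ∧ T = (f T).restrict T.height

/-- The conditions of `Q₀`: extendible trees `T` whose levels with index in `S` are the ones
prescribed by `f`. -/
structure TreeForcing (S : Set (Set.Iio (ω_ 1 : Ordinal.{0})))
    (f : CountableTree → CountableTree) where
  tree : CountableTree
  extendible : tree.Extendible
  mandatory : ∀ β ∈ S, β.1 < tree.height → tree.restrict (β.1 + 1) = f (tree.restrict β.1)

namespace TreeForcing

variable {S : Set (Set.Iio (ω_ 1 : Ordinal.{0}))} {f : CountableTree → CountableTree}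

/-- `T₀ ≤ T₁` iff `T₀` is an end-extension of `T₁`, i.e. `T₁ = T₀ ↾ height T₁`. -/
instance instPreorder : Preorder (TreeForcing S f) where
  le T₀ T₁ := T₁.tree = T₀.tree.restrict T₁.tree.height
  le_refl T := T.tree.restrict_height.symm
  le_trans T₀ T₁ T₂ h₀₁ h₁₂ := by
    have hle : T₂.tree.height ≤ T₁.tree.height := by
      conv_lhs => rw [h₁₂]
      exact T₁.tree.height_restrict_le _
    have h : T₂.tree = (T₀.tree.restrict T₁.tree.height).restrict T₂.tree.height := by
      rw [← h₀₁]
      exact h₁₂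
    rwa [T₀.tree.restrict_restrict hle] at h

theorem carrier_mono {T₀ T₁ : TreeForcing S f} (h : T₀ ≤ T₁) {x : Node}
    (hx : x ∈ T₁.tree.carrier) : x ∈ T₀.tree.carrier := by
  have h' : T₁.tree = T₀.tree.restrict T₁.tree.height := h
  rw [h'] at hx
  exact hx.1

theorem lt_mono {T₀ T₁ : TreeForcing S f} (h : T₀ ≤ T₁) {x y : Node}
    (hxy : T₁.tree.lt x y) : T₀.tree.lt x y := by
  have h' : T₁.tree = T₀.tree.restrict T₁.tree.height := h
  rw [h'] at hxy
  exact hxy.1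

variable (S f)

/-- The truth value of "`x` is a node of the generic tree", the generic tree being the union of
all trees in the generic filter. -/
noncomputable def genericMem (x : Node) : RO (TreeForcing S f) :=
  Heyting.Regular.toRegular ⟨{T | x ∈ T.tree.carrier}, fun _ _ h hx => carrier_mono h hx⟩

/-- The truth value of "`x` is below `y` in the generic tree". -/
noncomputable def genericLt (x y : Node) : RO (TreeForcing S f) :=
  Heyting.Regular.toRegular ⟨{T | T.tree.lt x y}, fun _ _ h hxy => lt_mono h hxy⟩

theorem genericLt_le (x y : Node) : genericLt S f x y ≤ genericMem S f x ⊓ genericMem S f y :=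
  le_inf (Heyting.Regular.toRegular.monotone fun T h => (T.tree.lt_mem h).1)
    (Heyting.Regular.toRegular.monotone fun T h => (T.tree.lt_mem h).2)

theorem genericLt_trans (x y z : Node) :
    genericLt S f x y ⊓ genericLt S f y z ≤ genericLt S f x z := by
  rw [← Heyting.Regular.coe_le_coe, Heyting.Regular.coe_inf]
  simp only [genericLt, Heyting.Regular.coe_toRegular]
  rw [← compl_compl_inf_distrib]
  exact compl_le_compl (compl_le_compl fun T h => T.tree.trans h.1 h.2)

open Classical in
/-- The `Q₀`-name for the generic tree as a forcing notion: `x` is a stronger condition than `y`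
iff `y` is below or equal to `x` in the tree. -/
noncomputable def genericTree : NamedPreorder (RO (TreeForcing S f)) Node where
  mem := genericMem S f
  le x y := genericLt S f y x ⊔ if x = y then genericMem S f x else ⊥
  le_mem x y := by
    refine sup_le ((genericLt_le S f y x).trans (le_of_eq (inf_comm _ _))) ?_
    split_ifs with h
    · subst h; simp
    · exact bot_le
  refl x := by simp
  trans x y z := by
    by_cases h : x = y
    · subst h
      exact inf_le_right
    by_cases h' : y = z
    · subst h'
      exact inf_le_left
    simp only [h, h', if_false, sup_bot_eq]
    rw [inf_comm]
    exact (genericLt_trans S f z y x).trans le_sup_left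

end TreeForcing

/-- The two-step iteration `P = Q₀ * Q̇₁`, where `Q₀` adds the generic tree and `Q̇₁` is the
generic tree. -/
abbrev MandatoryIteration (S : Set (Set.Iio (ω_ 1 : Ordinal.{0})))
    (f : CountableTree → CountableTree) : Type :=
  TwoStep (TreeForcing.genericTree S f)

end CutChoose

namespace CutChoose

/-! Pairs `(T, x)` of a condition `T` and a node `x` of it are dense in the iteration
(`PairCond.isDensePresentation`), so everything about the algebra is proved for any complete Boolean
algebra in which these pairs are dense. The levels off `S` and the levels in `S` play opposite
roles.

Off `S` the next level may be chosen. Given countably many open dense sets of pairs, one grows a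
tree in `ω` steps up to a height `δ ∉ S`, steering through every node a cofinal branch that meets
all of them, and puts new nodes on top of these branches only. Then every node on level `δ` lies in
all the given dense sets (`PairCond.exists_sealed`). Sealing bounds antichains and chains of the
generic tree, decides countably many choices at once (distributivity), and bounds the value of a
name by a countable set after extending the tree coordinate alone. As that coordinate is `σ`-closed,
properness follows as for `σ`-closed forcing.

In `S` the next level is dictated by `f` and is countable. If II could keep winning descending
plays, one could run `2^ω` plays simultaneously over a common sequence of trees, making their nodes
split, with union `U` of height `δ ∈ S`. Each play has a nonzero meet, hence forces a node on level
`δ` of `f U` above all its nodes; different plays give different nodes, which is too many for a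
countable tree (`PairCond.not_strategy`).

For cut-and-choose, a winning strategy of II is turned into such descending plays. A Bernstein-set
argument shows that for each cover of the unit by `2^ω` pieces, some continuation of any position
brings the chosen meet below one piece. As the pairs number at most `2^ω`, the meets reachable from
any position are therefore dense below some nonzero element
(`DecidingPositions.exists_dense_below`), and the same fusion applies. -/

theorem countable_Iio {δ : Ordinal.{0}} (h : δ < ω_ 1) : (Set.Iio δ).Countable := by
  rw [← Cardinal.le_aleph0_iff_set_countable, Cardinal.mk_Iio_ordinal, Cardinal.lift_le_aleph0,
    ← Cardinal.lt_aleph_one_iff, ← Cardinal.lt_ord]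
  simpa using h

theorem type_lt_omega_one {α : Type} [Countable α] (r : α → α → Prop) [IsWellOrder α r] :
    Ordinal.type r < ω_ 1 := by
  rw [← Cardinal.ord_aleph, Cardinal.lt_ord, Ordinal.card_type, Cardinal.lt_aleph_one_iff]
  exact Cardinal.mk_le_aleph0

theorem add_one_lt_omega_one {α : Ordinal.{0}} (h : α < ω_ 1) : α + 1 < ω_ 1 :=
  (isSuccLimit_omega 1).add_one_lt h

/-! ### Countable trees: end-extensions, unions, cofinal branches, new top levels -/

namespace CountableTree

variable (T : CountableTree)

/-- `x` is below or equal to `y` in `T`. -/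
def Le (x y : Node) : Prop := T.lt x y ∨ x = y

theorem not_lt_self (x : Node) : ¬ T.lt x x := fun h => (T.level_lt_level h).false

theorem Le.refl {T : CountableTree} (x : Node) : T.Le x x := Or.inr rfl

theorem Le.trans {T : CountableTree} {x y z : Node} (h : T.Le x y) (h' : T.Le y z) : T.Le x z := by
  rcases h with h | rfl
  · rcases h' with h' | rfl
    · exact Or.inl (T.trans h h')
    · exact Or.inl h
  · exact h'

theorem Le.level_le {T : CountableTree} {x y : Node} (h : T.Le x y) : T.level x ≤ T.level y := by
  rcases h with h | rfl
  · exact (T.level_lt_level h).le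
  · exact le_rfl

theorem Le.mem_left {T : CountableTree} {x y : Node} (h : T.Le x y) (hy : y ∈ T.carrier) :
    x ∈ T.carrier := by
  rcases h with h | rfl
  · exact (T.lt_mem h).1
  · exact hy

theorem trichotomy_of_lt {x y z : Node} (hx : T.lt x z) (hy : T.lt y z) :
    T.lt x y ∨ x = y ∨ T.lt y x := by
  have := T.wellOrder z
  rcases trichotomous_of (fun a b : {y // T.lt y z} => T.lt a b) ⟨x, hx⟩ ⟨y, hy⟩ with h | h | h
  · exact Or.inl h
  · exact Or.inr (Or.inl (congrArg Subtype.val h))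
  · exact Or.inr (Or.inr h)

theorem le_total_of_le {x y z : Node} (hx : T.Le x z) (hy : T.Le y z) : T.Le x y ∨ T.lt y x := by
  rcases hx with hx | rfl
  · rcases hy with hy | rfl
    · rcases T.trichotomy_of_lt hx hy with h | h | h
      · exact Or.inl (Or.inl h)
      · exact Or.inl (Or.inr h)
      · exact Or.inr h
    · exact Or.inl (Or.inl hx)
  · rcases hy with hy | rfl
    · exact Or.inr hy
    · exact Or.inl (Or.inr rfl)

/-- Two nodes below a common node are ordered as their levels. -/
theorem le_of_level_le {x y z : Node} (hx : T.Le x z) (hy : T.Le y z)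
    (h : T.level x ≤ T.level y) : T.Le x y :=
  (T.le_total_of_le hx hy).resolve_right fun h' => (T.level_lt_level h').not_ge h

theorem level_eq_type (x : Node) [IsWellOrder {y // T.lt y x} (fun a b => T.lt a b)] :
    T.level x = Ordinal.type (fun a b : {y // T.lt y x} => T.lt a b) := rfl

/-- The predecessors of `x` are well-ordered in type `T.level x`, and the `γ`-th of them has exactly
the earlier ones as its own predecessors. -/
theorem exists_lt_level_eq {x : Node} {γ : Ordinal.{0}} (h : γ < T.level x) :
    ∃ y, T.lt y x ∧ T.level y = γ := by
  have := T.wellOrder x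
  obtain ⟨a, ha⟩ := Ordinal.typein_surj (fun a b : {y // T.lt y x} => T.lt a b) h
  refine ⟨a.1, a.2, ?_⟩
  have := T.wellOrder a.1
  rw [← ha, ← Ordinal.type_subrel, level_eq_type]
  refine Ordinal.type_eq.2 ⟨⟨⟨fun y => ⟨⟨y.1, T.trans y.2 a.2⟩, y.2⟩, fun y => ⟨y.1.1, y.2⟩,
    fun _ => rfl, fun _ => rfl⟩, ?_⟩⟩
  exact Iff.rfl

theorem exists_le_level_eq {x : Node} {γ : Ordinal.{0}} (h : γ ≤ T.level x) :
    ∃ y, T.Le y x ∧ T.level y = γ := by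
  rcases h.lt_or_eq with h | rfl
  · obtain ⟨y, hy, hy'⟩ := T.exists_lt_level_eq h
    exact ⟨y, Or.inl hy, hy'⟩
  · exact ⟨x, Or.inr rfl, rfl⟩

theorem level_le {x : Node} {α : Ordinal.{0}} (h : ∀ y, T.lt y x → T.level y < α) :
    T.level x ≤ α := by
  by_contra hlt
  obtain ⟨y, hy, hy'⟩ := T.exists_lt_level_eq (not_le.1 hlt)
  exact (h y hy).ne hy'

theorem exists_level_eq {γ : Ordinal.{0}} (h : γ < T.height) : ∃ x ∈ T.carrier, T.level x = γ := by
  have : ∃ x ∈ T.carrier, γ ≤ T.level x := by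
    by_contra! hc
    exact (T.height_le hc).not_gt h
  obtain ⟨x, hx, hle⟩ := this
  obtain ⟨y, hy, hy'⟩ := T.exists_le_level_eq hle
  exact ⟨y, hy.mem_left hx, hy'⟩

theorem level_lt_omega_one (x : Node) : T.level x < ω_ 1 := by
  have := T.wellOrder x
  have hc : Countable {y // T.lt y x} := (T.countable.mono fun y hy => (T.lt_mem hy).1).to_subtype
  rw [level_eq_type]
  exact type_lt_omega_one _

theorem height_lt_omega_one : T.height < ω_ 1 := by
  have := T.countable.to_subtype
  refine (T.height_le (α := ⨆ x : T.carrier, (T.level x + 1)) ?_).trans_lt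
    (Ordinal.iSup_lt_omega_one fun x => add_one_lt_omega_one (T.level_lt_omega_one x))
  intro x hx
  exact (lt_add_one _).trans_le (Ordinal.le_iSup (fun x : T.carrier => T.level x + 1) ⟨x, hx⟩)

theorem level_congr {T T' : CountableTree} {x : Node} (h : ∀ y, T.lt y x ↔ T'.lt y x)
    (h' : ∀ a b, T.lt b x → (T.lt a b ↔ T'.lt a b)) : T.level x = T'.level x := by
  have := T.wellOrder x
  have := T'.wellOrder x
  exact Ordinal.type_eq.2 ⟨⟨Equiv.subtypeEquivRight h, fun {a b} => (h' a b b.2).symm⟩⟩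

/-- `T'` is an end-extension of `T`. -/
def EndExt (T' T : CountableTree) : Prop := T = T'.restrict T.height

namespace EndExt

variable {T T' T'' : CountableTree}

theorem mem_iff (h : EndExt T' T) {x : Node} :
    x ∈ T.carrier ↔ x ∈ T'.carrier ∧ T'.level x < T.height := by
  conv_lhs => rw [h]
  exact Iff.rfl

theorem mem (h : EndExt T' T) {x : Node} (hx : x ∈ T.carrier) : x ∈ T'.carrier :=
  (h.mem_iff.1 hx).1

theorem lt_iff (h : EndExt T' T) {x y : Node} (hy : y ∈ T.carrier) :
    T.lt x y ↔ T'.lt x y := by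
  have hy' := hy
  rw [h] at hy'
  conv_lhs => rw [h]
  exact T'.restrict_lt_iff hy'

theorem lt (h : EndExt T' T) {x y : Node} (hxy : T.lt x y) : T'.lt x y :=
  (h.lt_iff (T.lt_mem hxy).2).1 hxy

theorem le_iff (h : EndExt T' T) {x y : Node} (hy : y ∈ T.carrier) :
    T.Le x y ↔ T'.Le x y := or_congr (h.lt_iff hy) Iff.rfl

theorem le (h : EndExt T' T) {x y : Node} (hxy : T.Le x y) : T'.Le x y :=
  hxy.imp h.lt id

theorem level_eq (h : EndExt T' T) {x : Node} (hx : x ∈ T.carrier) :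
    T.level x = T'.level x := by
  have hx' := hx
  rw [h] at hx'
  conv_lhs => rw [h]
  exact T'.level_restrict hx'

theorem height_le (h : EndExt T' T) : T.height ≤ T'.height :=
  T.height_le fun x hx => by
    rw [h.level_eq hx]
    exact T'.level_lt_height (h.mem hx)

theorem trans (h : EndExt T'' T') (h' : EndExt T' T) : EndExt T'' T := by
  have h₁ : T = (T''.restrict T'.height).restrict T.height := by
    rw [← show T' = _ from h]
    exact h'
  rwa [T''.restrict_restrict h'.height_le] at h₁

/-- The second hypothesis makes predecessors, hence levels, agree in both trees; the third says that
no new node is inserted below the height of `T`. -/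
theorem of_forall (hc : ∀ x ∈ T.carrier, x ∈ T'.carrier)
    (hlt : ∀ x y, y ∈ T.carrier → (T.lt x y ↔ T'.lt x y))
    (hlev : ∀ x ∈ T'.carrier, T'.level x < T.height → x ∈ T.carrier) : EndExt T' T := by
  have hl : ∀ x ∈ T.carrier, T.level x = T'.level x := fun x hx =>
    level_congr (fun y => hlt y x hx) fun a b hb => hlt a b (T.lt_mem hb).1
  have hm : ∀ x, x ∈ T.carrier ↔ x ∈ T'.carrier ∧ T'.level x < T.height := fun x =>
    ⟨fun hx => ⟨hc x hx, by rw [← hl x hx]; exact T.level_lt_height hx⟩, fun hx => hlev x hx.1 hx.2⟩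
  rw [EndExt]
  ext x y
  · exact hm x
  · constructor
    · intro h
      have := T.lt_mem h
      exact ⟨(hlt x y this.2).1 h, (hm x).1 this.1, (hm y).1 this.2⟩
    · intro h
      exact (hlt x y ((hm y).2 h.2.2)).2 h.1

/-- Two end-extensions of which one is at least as high are comparable. -/
theorem of_common (h : EndExt T'' T) (h' : EndExt T'' T') (hle : T'.height ≤ T.height) :
    EndExt T T' := by
  have h₁ : T' = (T''.restrict T.height).restrict T'.height := by
    rw [T''.restrict_restrict hle]
    exact h'
  rwa [← show T = _ from h] at h₁

theorem restrict_eq (h : EndExt T' T) {β : Ordinal.{0}} (hβ : β ≤ T.height) :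
    T'.restrict β = T.restrict β := by
  conv_rhs => rw [h]
  rw [T'.restrict_restrict hβ]

end EndExt

/-- A strict order relation with a rank function, whose initial segments are linear, is a
well-order on initial segments. -/
theorem isWellOrder_of_rank {lt : Node → Node → Prop} {p : Node → Prop} (rk : Node → Ordinal.{0})
    (hrk : ∀ x y, p x → p y → lt x y → rk x < rk y)
    (htri : ∀ x y, p x → p y → lt x y ∨ x = y ∨ lt y x) :
    IsWellOrder {y // p y} (fun a b => lt a b) :=
  { wf := Subrelation.wf (fun {a b} h => hrk a b a.2 b.2 h)
      (InvImage.wf (fun a : {y // p y} => rk a) Ordinal.lt_wf)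
    trichotomous := fun a b h1 h2 => by
      rcases htri a b a.2 b.2 with h | h | h
      · exact absurd h h1
      · exact Subtype.ext h
      · exact absurd h h2 }

section Union

variable (t : ℕ → CountableTree) (ht : ∀ n m, n ≤ m → EndExt (t m) (t n))

/-- The union of a chain of end-extensions. -/
def union : CountableTree where
  carrier := ⋃ n, (t n).carrier
  lt x y := ∃ n, (t n).lt x y
  countable := Set.countable_iUnion fun n => (t n).countable
  lt_mem := fun ⟨n, h⟩ => ⟨Set.mem_iUnion.2 ⟨n, ((t n).lt_mem h).1⟩,
    Set.mem_iUnion.2 ⟨n, ((t n).lt_mem h).2⟩⟩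
  trans := fun ⟨n, h⟩ ⟨m, h'⟩ => ⟨max n m, (t _).trans ((ht n _ (le_max_left n m)).lt h)
    ((ht m _ (le_max_right n m)).lt h')⟩
  wellOrder x := by
    by_cases hx : ∃ n, x ∈ (t n).carrier
    · obtain ⟨n, hn⟩ := hx
      have key : ∀ a b m, b ∈ (t n).carrier → (t m).lt a b → (t n).lt a b := fun a b m hb h =>
        ((ht n (max n m) (le_max_left n m)).lt_iff hb).2 ((ht m _ (le_max_right n m)).lt h)
      have key' : ∀ y, (∃ m, (t m).lt y x) → (t n).lt y x := fun y ⟨m, h⟩ => key y x m hn h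
      refine isWellOrder_of_rank (lt := fun a b => ∃ n, (t n).lt a b) (t n).level ?_ ?_
      · rintro a b ha hb ⟨m, h⟩
        exact (t n).level_lt_level (key a b m ((t n).lt_mem (key' b hb)).1 h)
      · intro a b ha hb
        exact ((t n).trichotomy_of_lt (key' a ha) (key' b hb)).imp (fun h => ⟨n, h⟩)
          (Or.imp id fun h => ⟨n, h⟩)
    · have : ∀ y, ¬ ∃ n, (t n).lt y x := fun y ⟨n, h⟩ => hx ⟨n, ((t n).lt_mem h).2⟩
      exact isWellOrder_of_rank (lt := fun a b => ∃ n, (t n).lt a b) (fun _ => 0)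
        (fun a _ h => absurd h (this a))
          fun a _ h => absurd h (this a)

theorem mem_union {x : Node} : x ∈ (union t ht).carrier ↔ ∃ n, x ∈ (t n).carrier := Set.mem_iUnion

theorem union_lt_iff {x y : Node} {n : ℕ} (hy : y ∈ (t n).carrier) :
    (t n).lt x y ↔ (union t ht).lt x y :=
  ⟨fun h => ⟨n, h⟩, fun ⟨m, h⟩ => ((ht n (max n m) (le_max_left n m)).lt_iff hy).2
    ((ht m _ (le_max_right n m)).lt h)⟩

theorem level_union {x : Node} {n : ℕ} (hx : x ∈ (t n).carrier) :
    (t n).level x = (union t ht).level x :=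
  level_congr (fun _ => union_lt_iff t ht hx) fun _ _ hb =>
    union_lt_iff t ht ((t n).lt_mem hb).1

theorem endExt_union (n : ℕ) : EndExt (union t ht) (t n) := by
  refine .of_forall (fun x hx => (mem_union t ht).2 ⟨n, hx⟩) (fun x y hy => union_lt_iff t ht hy) ?_
  intro x hx hlev
  obtain ⟨m, hm⟩ := (mem_union t ht).1 hx
  rw [← level_union t ht hm] at hlev
  have hm' := (ht m (max m n) (le_max_left m n))
  rw [hm'.level_eq hm] at hlev
  exact (ht n (max m n) (le_max_right m n)).mem_iff.2 ⟨hm'.mem hm, hlev⟩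

theorem lt_height_union {γ : Ordinal.{0}} (h : γ < (union t ht).height) :
    ∃ n, γ < (t n).height := by
  obtain ⟨x, hx, rfl⟩ := (union t ht).exists_level_eq h
  obtain ⟨n, hn⟩ := (mem_union t ht).1 hx
  exact ⟨n, by rw [← level_union t ht hn]; exact (t n).level_lt_height hn⟩

theorem Extendible.union (he : ∀ n, (t n).Extendible) : (union t ht).Extendible := by
  intro x hx γ hγ
  obtain ⟨n, hn⟩ := (mem_union t ht).1 hx
  obtain ⟨m, hm⟩ := lt_height_union t ht hγ
  have h₁ := ht n (max n m) (le_max_left n m)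
  have h₂ := ht m (max n m) (le_max_right n m)
  have h := endExt_union t ht (max n m)
  obtain ⟨y, hy, hy', hxy⟩ := he (max n m) x (h₁.mem hn) γ (hm.trans_le h₂.height_le)
  exact ⟨y, h.mem hy, by rw [← h.level_eq hy, hy'], hxy.imp h.lt (Or.imp id h.lt)⟩

end Union

/-- `b` is a branch of `T` through all levels. -/
structure IsCofinalBranch (b : Set Node) : Prop where
  subset : b ⊆ T.carrier
  chain : ∀ x ∈ b, ∀ y ∈ b, T.lt x y ∨ x = y ∨ T.lt y x
  lower : ∀ x y, y ∈ b → T.lt x y → x ∈ b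
  cofinal : ∀ γ < T.height, ∃ x ∈ b, T.level x = γ

/-- The branch generated by an increasing sequence of nodes. -/
def branchOf (x : ℕ → Node) : Set Node := {y | ∃ n, T.Le y (x n)}

theorem le_of_monotone {x : ℕ → Node} (hx : ∀ n, T.Le (x n) (x (n + 1))) {n m : ℕ} (h : n ≤ m) :
    T.Le (x n) (x m) := by
  induction m, h using Nat.le_induction with
  | base => exact Le.refl _
  | succ m _ ih => exact ih.trans (hx m)

theorem isCofinalBranch_branchOf {x : ℕ → Node} (h0 : ∀ n, x n ∈ T.carrier)
    (hx : ∀ n, T.Le (x n) (x (n + 1))) (hc : ∀ γ < T.height, ∃ n, γ ≤ T.level (x n)) :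
    T.IsCofinalBranch (T.branchOf x) where
  subset := fun y ⟨n, hn⟩ => hn.mem_left (h0 n)
  chain := by
    rintro y ⟨n, hn⟩ z ⟨m, hm⟩
    have := T.le_total_of_le (hn.trans (T.le_of_monotone hx (le_max_left n m)))
      (hm.trans (T.le_of_monotone hx (le_max_right n m)))
    rwa [Le, or_assoc] at this
  lower := fun y z ⟨n, hn⟩ h => ⟨n, Le.trans (Or.inl h) hn⟩
  cofinal := fun γ hγ => by
    obtain ⟨n, hn⟩ := hc γ hγ
    obtain ⟨y, hy, hy'⟩ := T.exists_le_level_eq hn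
    exact ⟨y, ⟨n, hy⟩, hy'⟩

section AddTop

variable (b : ℕ → Set Node) (hb : ∀ n, T.IsCofinalBranch (b n)) (g : ℕ → Node)
  (hg : Function.Injective g) (hgT : ∀ n, g n ∉ T.carrier)

/-- The tree obtained from `T` by putting a new node `g n` on top of each cofinal branch `b n`. -/
def addTop : CountableTree where
  carrier := T.carrier ∪ Set.range g
  lt x y := T.lt x y ∨ ∃ n, y = g n ∧ x ∈ b n
  countable := T.countable.union (Set.countable_range g)
  lt_mem := by
    rintro x y (h | ⟨n, rfl, h⟩)
    · exact ⟨Or.inl (T.lt_mem h).1, Or.inl (T.lt_mem h).2⟩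
    · exact ⟨Or.inl ((hb n).subset h), Or.inr ⟨n, rfl⟩⟩
  trans := by
    rintro x y z (h | ⟨n, rfl, h⟩) (h' | ⟨m, rfl, h'⟩)
    · exact Or.inl (T.trans h h')
    · exact Or.inr ⟨m, rfl, (hb m).lower _ _ h' h⟩
    · exact absurd (T.lt_mem h').1 (hgT n)
    · exact absurd ((hb m).subset h') (hgT n)
  wellOrder z := by
    have key : ∀ x y, (T.lt y z ∨ ∃ n, z = g n ∧ y ∈ b n) →
        (T.lt x y ∨ ∃ n, y = g n ∧ x ∈ b n) → T.lt x y := by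
      rintro x y hy (h | ⟨n, rfl, -⟩)
      · exact h
      · rcases hy with hy | ⟨m, -, hy⟩
        · exact absurd (T.lt_mem hy).1 (hgT n)
        · exact absurd ((hb m).subset hy) (hgT n)
    refine isWellOrder_of_rank T.level (fun x y _ hy h => T.level_lt_level (key x y hy h)) ?_
    rintro x y (h | ⟨n, rfl, h⟩) (h' | ⟨m, hm, h'⟩)
    · exact (T.trichotomy_of_lt h h').imp Or.inl (Or.imp id Or.inl)
    · exact absurd (hm ▸ (T.lt_mem h).2) (hgT m)
    · exact absurd (T.lt_mem h').2 (hgT n)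
    · obtain rfl := hg hm
      exact ((hb n).chain x h y h').imp Or.inl (Or.imp id Or.inl)

theorem addTop_lt_iff {x y : Node} (hy : y ∈ T.carrier) :
    T.lt x y ↔ (T.addTop b hb g hg hgT).lt x y :=
  ⟨Or.inl, fun h => h.resolve_right fun ⟨n, hn, _⟩ => hgT n (hn ▸ hy)⟩

theorem addTop_lt_top {x : Node} {n : ℕ} : (T.addTop b hb g hg hgT).lt x (g n) ↔ x ∈ b n :=
  ⟨fun h => h.elim (fun h => absurd (T.lt_mem h).2 (hgT n)) fun ⟨m, hm, h⟩ => by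
    rwa [hg hm], fun h => Or.inr ⟨n, rfl, h⟩⟩

theorem level_addTop {x : Node} (hx : x ∈ T.carrier) :
    T.level x = (T.addTop b hb g hg hgT).level x :=
  level_congr (fun _ => T.addTop_lt_iff b hb g hg hgT hx) fun _ _ hb' =>
    T.addTop_lt_iff b hb g hg hgT (T.lt_mem hb').1

theorem level_addTop_top (n : ℕ) : (T.addTop b hb g hg hgT).level (g n) = T.height := by
  refine le_antisymm (level_le _ fun y hy => ?_) ?_
  · rw [addTop_lt_top] at hy
    rw [← level_addTop _ _ _ _ _ _ ((hb n).subset hy)]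
    exact T.level_lt_height ((hb n).subset hy)
  · by_contra hlt
    obtain ⟨y, hy, hy'⟩ := (hb n).cofinal _ (not_le.1 hlt)
    have := level_lt_level _ ((T.addTop_lt_top b hb g hg hgT).2 hy)
    rw [← level_addTop _ _ _ _ _ _ ((hb n).subset hy), hy'] at this
    exact this.false

theorem endExt_addTop : EndExt (T.addTop b hb g hg hgT) T := by
  refine .of_forall (fun x hx => Or.inl hx) (fun x y hy => T.addTop_lt_iff b hb g hg hgT hy) ?_
  rintro x (hx | ⟨n, rfl⟩) hlev
  · exact hx
  · rw [level_addTop_top] at hlev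
    exact absurd hlev (lt_irrefl _)

theorem height_addTop : (T.addTop b hb g hg hgT).height = T.height + 1 := by
  refine le_antisymm (height_le _ ?_) ?_
  · rintro x (hx | ⟨n, rfl⟩)
    · rw [← level_addTop _ _ _ _ _ _ hx]
      exact (T.level_lt_height hx).trans (lt_add_one _)
    · rw [level_addTop_top]
      exact lt_add_one _
  · have := level_lt_height (T.addTop b hb g hg hgT) (x := g 0) (Or.inr ⟨0, rfl⟩)
    rw [level_addTop_top] at this
    exact Order.add_one_le_of_lt this

/-- Covering is what extendibility demands at the new level: each old node needs a top node above
it. A top node meets all lower levels because its branch is cofinal. -/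
theorem Extendible.addTop (hT : T.Extendible) (hcov : ∀ x ∈ T.carrier, ∃ n, x ∈ b n) :
    (T.addTop b hb g hg hgT).Extendible := by
  intro x hx γ hγ
  rw [height_addTop] at hγ
  rcases (Order.lt_add_one_iff.1 hγ).lt_or_eq with hγ | rfl
  · rcases hx with hx | ⟨n, rfl⟩
    · obtain ⟨y, hy, hy', h⟩ := hT x hx γ hγ
      exact ⟨y, Or.inl hy, by rw [← level_addTop _ _ _ _ _ _ hy, hy'],
        h.imp Or.inl (Or.imp id Or.inl)⟩
    · obtain ⟨y, hy, hy'⟩ := (hb n).cofinal γ hγ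
      exact ⟨y, Or.inl ((hb n).subset hy),
        by rw [← level_addTop _ _ _ _ _ _ ((hb n).subset hy), hy'],
        Or.inr (Or.inr ((T.addTop_lt_top b hb g hg hgT).2 hy))⟩
  · rcases hx with hx | ⟨n, rfl⟩
    · obtain ⟨n, hn⟩ := hcov x hx
      exact ⟨g n, Or.inr ⟨n, rfl⟩, level_addTop_top _ _ _ _ _ _ n,
        Or.inl ((T.addTop_lt_top b hb g hg hgT).2 hn)⟩
    · exact ⟨g n, Or.inr ⟨n, rfl⟩, level_addTop_top _ _ _ _ _ _ n, Or.inr (Or.inl rfl)⟩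

end AddTop

/-- If the comparable node on level `γ` lies below `x`, then `x` itself is already high enough. -/
theorem Extendible.exists_ge (hT : T.Extendible) {x : Node} (hx : x ∈ T.carrier) {γ : Ordinal.{0}}
    (hγ : γ < T.height) : ∃ y ∈ T.carrier, T.Le x y ∧ γ ≤ T.level y := by
  obtain ⟨y, hy, hy', h⟩ := hT x hx γ hγ
  rcases h with h | h | h
  · exact ⟨y, hy, Or.inl h, hy'.ge⟩
  · exact ⟨y, hy, Or.inr h, hy'.ge⟩
  · exact ⟨x, hx, Or.inr rfl, hy' ▸ (T.level_lt_level h).le⟩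

theorem uncountable_node : Uncountable Node := by
  rw [← Cardinal.aleph0_lt_mk_iff, Cardinal.mk_toType]
  simp

/-- There are infinitely many possible nodes outside a given tree. -/
theorem exists_fresh : ∃ g : ℕ → Node, Function.Injective g ∧ ∀ n, g n ∉ T.carrier := by
  have : (T.carrierᶜ).Infinite := by
    intro hf
    have := uncountable_node
    refine Set.not_countable_univ (α := Node) ?_
    rw [← Set.union_compl_self T.carrier]
    exact T.countable.union hf.countable
  have := this.to_subtype
  exact ⟨fun n => Infinite.natEmbedding (T.carrierᶜ : Set Node) n,
    Subtype.val_injective.comp (Infinite.natEmbedding _).injective,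
    fun n => (Infinite.natEmbedding (T.carrierᶜ : Set Node) n).2⟩

theorem isCofinalBranch_empty (h : T.carrier = ∅) : T.IsCofinalBranch ∅ where
  subset := Set.empty_subset _
  chain := by simp
  lower := by simp
  cofinal := fun γ hγ => by
    obtain ⟨x, hx, -⟩ := T.exists_level_eq hγ
    simp [h] at hx

/-- In an extendible tree there is a cofinal branch through every node. -/
theorem Extendible.exists_branch (hT : T.Extendible) {x : Node} (hx : x ∈ T.carrier) :
    ∃ b, T.IsCofinalBranch b ∧ x ∈ b := by
  have hne : (Set.Iio T.height).Nonempty := ⟨_, Set.mem_Iio.2 (T.level_lt_height hx)⟩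
  -- Reaching level `e n` at step `n`, for an enumeration `e` of the ordinals below the height,
  -- makes the branch cofinal without distinguishing limit and successor heights.
  obtain ⟨e, he⟩ := (countable_Iio T.height_lt_omega_one).exists_eq_range hne
  have hlt : ∀ n, e n < T.height := fun n => by
    have : e n ∈ Set.Iio T.height := he ▸ ⟨n, rfl⟩
    exact this
  have step : ∀ (n : ℕ) (x : T.carrier), ∃ y : T.carrier, T.Le x y ∧ e n ≤ T.level y :=
    fun n x => by
      obtain ⟨y, hy, h⟩ := hT.exists_ge T x.2 (hlt n)
      exact ⟨⟨y, hy⟩, h⟩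
  choose s hs using step
  let u : ℕ → T.carrier := fun n => Nat.rec ⟨x, hx⟩ s n
  refine ⟨T.branchOf (fun n => (u n).1), T.isCofinalBranch_branchOf (fun n => (u n).2)
    (fun n => (hs n (u n)).1) fun γ hγ => ?_, ⟨0, Or.inr rfl⟩⟩
  obtain ⟨n, rfl⟩ : γ ∈ Set.range e := he ▸ hγ
  exact ⟨n + 1, (hs n (u n)).2⟩

theorem Extendible.exists_branches (hT : T.Extendible) : ∃ b : ℕ → Set Node,
    (∀ n, T.IsCofinalBranch (b n)) ∧ ∀ x ∈ T.carrier, ∃ n, x ∈ b n := by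
  rcases T.carrier.eq_empty_or_nonempty with h | h
  · exact ⟨fun _ => ∅, fun _ => T.isCofinalBranch_empty h, by simp [h]⟩
  · obtain ⟨e, he⟩ := T.countable.exists_eq_range h
    have : ∀ n, ∃ b, T.IsCofinalBranch b ∧ e n ∈ b := fun n =>
      hT.exists_branch T (he ▸ ⟨n, rfl⟩)
    choose b hb hb' using this
    refine ⟨b, hb, fun x hx => ?_⟩
    obtain ⟨n, rfl⟩ : x ∈ Set.range e := he ▸ hx
    exact ⟨n, hb' n⟩

end CountableTree

-- One fresh node is put on top of each of countably many cofinal branches covering the tree. Trees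
-- that are not extendible get themselves as a junk value.
open CountableTree in
theorem exists_isMandatoryExtension : ∃ f, IsMandatoryExtension f := by
  have : ∀ T : CountableTree, ∃ T' : CountableTree, T.Extendible →
      T'.Extendible ∧ T'.height = T.height + 1 ∧ T = T'.restrict T.height := by
    intro T
    by_cases hT : T.Extendible
    · obtain ⟨b, hb, hcov⟩ := hT.exists_branches
      obtain ⟨g, hg, hgT⟩ := T.exists_fresh
      exact ⟨T.addTop b hb g hg hgT, fun _ => ⟨hT.addTop T b hb g hg hgT hcov,
        T.height_addTop b hb g hg hgT, T.endExt_addTop b hb g hg hgT⟩⟩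
    · exact ⟨T, fun h => absurd h hT⟩
  choose f hf using this
  exact ⟨f, hf⟩

end CutChoose

/-! ### Club and stationary subsets of `ω₁` -/

namespace CutChoose

/-- The set of countable ordinals. -/
abbrev Omega1 : Type 1 := Set.Iio (ω_ 1 : Ordinal.{0})

theorem exists_gt_of_countable {ι : Type*} [Countable ι] (h : ι → Ordinal.{0})
    (hh : ∀ i, h i < ω_ 1) : ∃ β < ω_ 1, ∀ i, h i < β := by
  rcases isEmpty_or_nonempty ι with hι | hι
  · exact ⟨0, (isSuccLimit_omega 1).bot_lt, fun i => isEmptyElim i⟩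
  obtain ⟨e, he⟩ := exists_surjective_nat ι
  refine ⟨⨆ n, (h (e n) + 1), Ordinal.iSup_lt_omega_one fun n => add_one_lt_omega_one (hh _), ?_⟩
  intro i
  obtain ⟨n, rfl⟩ := he i
  exact (lt_add_one _).trans_le (Ordinal.le_iSup (fun n => h (e n) + 1) n)

/-- Closure points of a function on finite sequences of countable ordinals. -/
theorem isClub_closurePoints (h : List Omega1 → Ordinal.{0}) (hh : ∀ l, h l < ω_ 1) :
    IsClub {δ : Omega1 | ∀ l : List Omega1, (∀ x ∈ l, x < δ) → h l < δ.1} := by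
  refine ⟨?_, ?_⟩
  · intro d hd hne _ a ha l hl
    have : ∃ δ ∈ d, ∀ x ∈ l, x < δ := by
      clear hd
      induction l with
      | nil => exact ⟨hne.some, hne.some_mem, by simp⟩
      | cons x l ih =>
        obtain ⟨δ, hδ, h1⟩ := ih fun y hy => hl y (List.mem_cons_of_mem _ hy)
        obtain ⟨δ', hδ', h2⟩ := (lt_isLUB_iff ha).1 (hl x List.mem_cons_self)
        rcases le_total δ δ' with hle | hle
        · refine ⟨δ', hδ', fun y hy => ?_⟩
          rcases List.mem_cons.1 hy with rfl | hy
          · exact h2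
          · exact (h1 y hy).trans_le hle
        · refine ⟨δ, hδ, fun y hy => ?_⟩
          rcases List.mem_cons.1 hy with rfl | hy
          · exact h2.trans_le hle
          · exact h1 y hy
    obtain ⟨δ, hδ, h1⟩ := this
    exact (hd hδ l h1).trans_le (ha.1 hδ)
  · intro a
    have step : ∀ β : Omega1, ∃ γ : Omega1, β < γ ∧
        ∀ l : List Omega1, (∀ x ∈ l, x < β) → h l < γ.1 := by
      intro β
      have hc : Countable (Set.Iio β.1) := (countable_Iio β.2).to_subtype
      let v : Set.Iio β.1 → Omega1 := fun x => ⟨x.1, (Set.mem_Iio.1 x.2).trans β.2⟩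
      -- There are only countably many lists below `β`; the index `none` carries `β` itself, so that
      -- the bound also exceeds `β`.
      obtain ⟨γ, hγ, hlt⟩ := exists_gt_of_countable
        (fun o : Option (List (Set.Iio β.1)) => o.elim β.1 fun l => h (l.map v)) (by
          rintro (_ | l)
          · exact β.2
          · exact hh _)
      refine ⟨⟨γ, hγ⟩, hlt none, fun l hl => ?_⟩
      have := hlt (some (l.pmap (fun x hx => ⟨x.1, hx⟩) hl))
      have heq : (l.pmap (fun x hx => (⟨x.1, hx⟩ : Set.Iio β.1)) hl).map v = l := by
        rw [List.map_pmap]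
        exact (List.pmap_eq_map (f := id) hl).trans (List.map_id l)
      rw [← heq]
      exact this
    choose s hs1 hs2 using step
    let u : ℕ → Omega1 := fun n => Nat.rec a (fun _ x => s x) n
    have hu : ∀ n, u (n + 1) = s (u n) := fun n => rfl
    have humono : Monotone u := monotone_nat_of_le_succ fun n => (hs1 (u n)).le
    have hsup : (⨆ n, (u n).1) < ω_ 1 := Ordinal.iSup_lt_omega_one fun n => (u n).2
    have hle : ∀ n, (u n).1 ≤ ⨆ n, (u n).1 := fun n => Ordinal.le_iSup (fun n => (u n).1) n
    refine ⟨⟨_, hsup⟩, ?_, hle 0⟩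
    intro l hl
    have : ∃ n, ∀ x ∈ l, x < u n := by
      induction l with
      | nil => exact ⟨0, by simp⟩
      | cons x l ih =>
        obtain ⟨n, hn⟩ := ih fun y hy => hl y (List.mem_cons_of_mem _ hy)
        obtain ⟨m, hm⟩ := Ordinal.lt_iSup_iff.1 (hl x List.mem_cons_self)
        refine ⟨max n m, fun y hy => ?_⟩
        rcases List.mem_cons.1 hy with rfl | hy
        · exact lt_of_lt_of_le (b := u m) hm (humono (le_max_right n m))
        · exact (hn y hy).trans_le (humono (le_max_left n m))
    obtain ⟨n, hn⟩ := this
    exact (hs2 (u n) l hn).trans_le (hle (n + 1))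

theorem cof_omega1 : Order.cof Omega1 = ℵ₁ := by
  rw [Ordinal.cof_Iio, Ordinal.lift_omega]
  simp

theorem cof_omega1_ne : Order.cof Omega1 ≠ ℵ₀ := by
  rw [cof_omega1]
  exact Cardinal.aleph0_lt_aleph_one.ne'

/-- There is a stationary set of countable ordinals whose complement is stationary. -/
theorem exists_isStationary_compl :
    ∃ S : Set Omega1, IsStationary S ∧ IsStationary Sᶜ := by
  -- Otherwise every set contains or misses a club. With countable ordinals read as distinct binary
  -- sequences, each bit is constant on a club; the intersection of these countably many clubs is
  -- unbounded but has at most one point.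
  by_contra! hS
  have hne : Nonempty Omega1 := ⟨⟨0, (isSuccLimit_omega 1).bot_lt⟩⟩
  have hcard : Cardinal.lift.{0} #Omega1 ≤ Cardinal.lift.{1} #(ℕ → Bool) := by
    rw [Cardinal.mk_Iio_ordinal]
    simpa using Cardinal.aleph0_lt_continuum
  obtain ⟨r⟩ := Cardinal.lift_mk_le'.1 hcard
  have hclub : ∀ n, ∃ ε : Bool, ∃ C : Set Omega1, IsClub C ∧ ∀ x ∈ C, r x n = ε := by
    intro n
    have : ∀ ε, ¬ IsStationary {x | r x n = !ε} →
        ∃ C : Set Omega1, IsClub C ∧ ∀ x ∈ C, r x n = ε := by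
      intro ε h
      obtain ⟨C, hC, hd⟩ := not_isStationary_iff.1 h
      refine ⟨C, hC, fun x hx => ?_⟩
      have : x ∉ {x | r x n = !ε} := fun h => Set.disjoint_left.1 hd h hx
      simpa using this
    by_cases h : IsStationary {x | r x n = true}
    · refine ⟨true, this true ?_⟩
      have := hS _ h
      convert this using 2
      ext x; simp
    · exact ⟨false, this false h⟩
  choose ε C hC hε using hclub
  have hC' := IsClub.iInter_of_countable cof_omega1_ne hC
  obtain ⟨x, hx, -⟩ := hC'.isCofinal hne.some
  obtain ⟨y, hy, hxy⟩ := hC'.isCofinal ⟨x.1 + 1, add_one_lt_omega_one x.2⟩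
  have : r x = r y := funext fun n => by
    rw [hε n x (Set.mem_iInter.1 hx n), hε n y (Set.mem_iInter.1 hy n)]
  have := r.injective this
  subst this
  exact ((lt_add_one x.1).trans_le hxy).false

end CutChoose

/-! ### The forcing with trees: `σ`-closure, heights, fusion and sealing -/

namespace CutChoose

/-- In a `σ`-closed forcing, countably many open dense properties can be met at once. -/
theorem IsSigmaClosed.exists_forall {P : Type*} [Preorder P] (hP : IsSigmaClosed P) {ι : Type*}
    [Countable ι] {R : ι → P → Prop} (hR : ∀ i p q, q ≤ p → R i p → R i q) (p : P)
    (hd : ∀ i, ∀ q ≤ p, ∃ r ≤ q, R i r) : ∃ q ≤ p, ∀ i, R i q := by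
  rcases isEmpty_or_nonempty ι with hι | hι
  · exact ⟨p, le_rfl, fun i => isEmptyElim i⟩
  obtain ⟨e, he⟩ := exists_surjective_nat ι
  have step : ∀ (n : ℕ) (q : Set.Iic p), ∃ r : Set.Iic p, r.1 ≤ q.1 ∧ R (e n) r.1 := by
    rintro n ⟨q, hq⟩
    obtain ⟨r, hr, h⟩ := hd (e n) q hq
    exact ⟨⟨r, hr.trans hq⟩, hr, h⟩
  choose s hs1 hs2 using step
  let u : ℕ → Set.Iic p := fun n => Nat.rec ⟨p, le_rfl⟩ s n
  obtain ⟨q, hq⟩ := hP (fun n => (u n).1) (antitone_nat_of_succ_le fun n => hs1 n (u n))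
  refine ⟨q, hq 0, fun i => ?_⟩
  obtain ⟨n, rfl⟩ := he i
  exact hR _ _ _ (hq (n + 1)) (hs2 n (u n))

open CountableTree

namespace TreeForcing

variable {S : Set Omega1} {f : CountableTree → CountableTree}

/-- The union of a descending sequence of conditions. -/
def unionCond (t : ℕ → TreeForcing S f) (ht : Antitone t) : TreeForcing S f where
  tree := CountableTree.union (fun n => (t n).tree) fun _ _ h => ht h
  extendible := Extendible.union _ _ fun n => (t n).extendible
  mandatory β hβ hlt := by
    obtain ⟨n, hn⟩ := lt_height_union _ _ hlt
    have h := endExt_union (fun n => (t n).tree) (fun _ _ h => ht h) n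
    rw [h.restrict_eq hn.le, h.restrict_eq (Order.add_one_le_of_lt hn)]
    exact (t n).mandatory β hβ hn

theorem unionCond_le (t : ℕ → TreeForcing S f) (ht : Antitone t) (n : ℕ) :
    unionCond t ht ≤ t n :=
  endExt_union (fun n => (t n).tree) (fun _ _ h => ht h) n

theorem lt_height_unionCond (t : ℕ → TreeForcing S f) (ht : Antitone t) {γ : Ordinal.{0}}
    (h : γ < (unionCond t ht).tree.height) : ∃ n, γ < (t n).tree.height :=
  lt_height_union (fun n => (t n).tree) (fun _ _ h => ht h) h

variable (S f) in
theorem isSigmaClosed : IsSigmaClosed (TreeForcing S f) :=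
  fun t ht => ⟨unionCond t ht, unionCond_le t ht⟩

/-- The mandatory extension of a condition. -/
def succCond (hf : IsMandatoryExtension f) (T : TreeForcing S f) : TreeForcing S f where
  tree := f T.tree
  extendible := (hf T.tree T.extendible).1
  mandatory β hβ hlt := by
    obtain ⟨-, h1, h2⟩ := hf T.tree T.extendible
    rw [h1] at hlt
    rcases (Order.lt_add_one_iff.1 hlt).lt_or_eq with h | h
    · rw [EndExt.restrict_eq h2 h.le, EndExt.restrict_eq h2 (Order.add_one_le_of_lt h)]
      exact T.mandatory β hβ h
    · rw [h, ← h2, ← h1, restrict_height]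

theorem succCond_le (hf : IsMandatoryExtension f) (T : TreeForcing S f) : succCond hf T ≤ T :=
  (hf T.tree T.extendible).2.2

theorem height_succCond (hf : IsMandatoryExtension f) (T : TreeForcing S f) :
    (succCond hf T).tree.height = T.tree.height + 1 :=
  (hf T.tree T.extendible).2.1

theorem height_mono {T T' : TreeForcing S f} (h : T' ≤ T) : T.tree.height ≤ T'.tree.height :=
  EndExt.height_le h

/-- By `σ`-closure all heights below `α` are exceeded at once. One more level is then added by `f`,
which is legal whether or not the current height belongs to `S`. -/
theorem exists_height_gt (hf : IsMandatoryExtension f) {α : Ordinal.{0}} (hα : α < ω_ 1)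
    (T : TreeForcing S f) : ∃ T' ≤ T, α < T'.tree.height := by
  induction α using WellFoundedLT.induction generalizing T with
  | ind α ih =>
  have := (countable_Iio hα).to_subtype
  obtain ⟨T', hT', h⟩ := (isSigmaClosed S f).exists_forall (ι := Set.Iio α)
    (R := fun β T => β.1 < T.tree.height) (fun β p q hq h => h.trans_le (height_mono hq)) T
    fun β q _ => ih β.1 β.2 (lt_trans β.2 hα) q
  refine ⟨succCond hf T', (succCond_le hf T').trans hT', ?_⟩
  rw [height_succCond, Order.lt_add_one_iff]
  exact le_of_forall_lt fun γ hγ => h ⟨γ, hγ⟩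

/-- At a level outside `S`, new nodes can be put on top of arbitrary cofinal branches covering
the tree. -/
theorem exists_addTop (T : TreeForcing S f) (b : ℕ → Set Node)
    (hb : ∀ n, T.tree.IsCofinalBranch (b n))
    (g : ℕ → Node) (hg : Function.Injective g) (hgT : ∀ n, g n ∉ T.tree.carrier)
    (hcov : ∀ x ∈ T.tree.carrier, ∃ n, x ∈ b n) (hS : ∀ β ∈ S, β.1 ≠ T.tree.height) :
    ∃ V ≤ T, V.tree.height = T.tree.height + 1 ∧
      (∀ x, x ∈ V.tree.carrier ↔ x ∈ T.tree.carrier ∨ x ∈ Set.range g) ∧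
      (∀ n x, V.tree.lt x (g n) ↔ x ∈ b n) ∧ ∀ n, V.tree.level (g n) = T.tree.height :=
  ⟨{  tree := T.tree.addTop b hb g hg hgT
      extendible := T.extendible.addTop _ b hb g hg hgT hcov
      mandatory := fun β hβ hlt => by
        have h := T.tree.endExt_addTop b hb g hg hgT
        rw [height_addTop] at hlt
        have hlt := (Order.lt_add_one_iff.1 hlt).lt_of_ne (hS β hβ)
        rw [h.restrict_eq hlt.le, h.restrict_eq (Order.add_one_le_of_lt hlt)]
        exact T.mandatory β hβ hlt },
    T.tree.endExt_addTop b hb g hg hgT, T.tree.height_addTop b hb g hg hgT, fun _ => Iff.rfl,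
    fun _ _ => T.tree.addTop_lt_top b hb g hg hgT, T.tree.level_addTop_top b hb g hg hgT⟩

/-- A construction by recursion, each step of which can be taken with arbitrarily high trees, can
be directed so that the union of the trees has its height in a given stationary set. -/
theorem exists_targeted {σ : Type*} (tr : σ → TreeForcing S f) (Inv : ℕ → σ → Prop)
    (Rel : ℕ → σ → σ → Prop)
    (hstep : ∀ n s, Inv n s → ∀ α < ω_ 1, ∃ s', Inv (n + 1) s' ∧ Rel n s s' ∧ tr s' ≤ tr s ∧
      α < (tr s').tree.height)
    {E : Set Omega1} (hE : IsStationary E) (s₀ : σ) (h₀ : Inv 0 s₀) :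
    ∃ s : ℕ → σ, s 0 = s₀ ∧ (∀ n, Inv n (s n)) ∧ (∀ n, Rel n (s n) (s (n + 1))) ∧
      Antitone (fun n => tr (s n)) ∧ ∃ δ ∈ E, (∀ n, (tr (s n)).tree.height < δ.1) ∧
      ∃ U : TreeForcing S f, (∀ n, U ≤ tr (s n)) ∧ U.tree.height = δ.1 ∧
        (∀ x ∈ U.tree.carrier, ∃ n, x ∈ (tr (s n)).tree.carrier) ∧
        ∀ γ < δ.1, ∃ n, γ < (tr (s n)).tree.height := by
  have hstep' : ∀ n s (α : Omega1), ∃ s', Inv n s → Inv (n + 1) s' ∧ Rel n s s' ∧ tr s' ≤ tr s ∧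
      α.1 < (tr s').tree.height := by
    intro n s α
    by_cases h : Inv n s
    · obtain ⟨s', hs'⟩ := hstep n s h α.1 α.2
      exact ⟨s', fun _ => hs'⟩
    · exact ⟨s, fun h' => absurd h' h⟩
  choose step hs using hstep'
  -- All finite runs are fixed in advance, indexed by the list of heights demanded, latest first.
  -- For a closure point `δ ∈ E` of the heights so reached, the demands enumerating `δ` lead to
  -- heights below `δ` and cofinal in it.
  let st : List Omega1 → σ := fun l => List.rec s₀ (fun α l ih => step l.length ih α) l
  have hst : ∀ α l, st (α :: l) = step l.length (st l) α := fun α l => rfl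
  have hInv : ∀ l, Inv l.length (st l) := by
    intro l
    induction l with
    | nil => exact h₀
    | cons α l ih => exact (hs _ _ α ih).1
  obtain ⟨δ, hδE, hδ⟩ := hE (isClub_closurePoints (fun l => (tr (st l)).tree.height)
    fun l => (tr (st l)).tree.height_lt_omega_one)
  have hne : (Set.Iio δ.1).Nonempty := ⟨_, Set.mem_Iio.2 (hδ [] (by simp))⟩
  obtain ⟨e, he⟩ := (countable_Iio δ.2).exists_eq_range hne
  have hlt : ∀ n, e n < δ.1 := fun n => Set.mem_Iio.1 (he ▸ ⟨n, rfl⟩)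
  let l : ℕ → List Omega1 := fun n => Nat.rec [] (fun n l => ⟨e n, (hlt n).trans δ.2⟩ :: l) n
  have hl : ∀ n, l (n + 1) = ⟨e n, (hlt n).trans δ.2⟩ :: l n := fun n => rfl
  have hlen : ∀ n, (l n).length = n := by
    intro n
    induction n with
    | zero => rfl
    | succ n ih => rw [hl, List.length_cons, ih]
  have hmem : ∀ n, ∀ x ∈ l n, x < δ := by
    intro n
    induction n with
    | zero => simp [l]
    | succ n ih =>
      intro x hx
      rw [hl] at hx
      rcases List.mem_cons.1 hx with rfl | hx
      · exact hlt n
      · exact ih x hx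
  have hI : ∀ n, Inv n (st (l n)) := fun n => by
    have := hInv (l n)
    rwa [hlen] at this
  have hnext : ∀ n, Rel n (st (l n)) (st (l (n + 1))) ∧ tr (st (l (n + 1))) ≤ tr (st (l n)) ∧
      e n < (tr (st (l (n + 1)))).tree.height := fun n => by
    rw [hl, hst, hlen]
    exact (hs _ _ _ (hI n)).2
  have hanti : Antitone fun n => tr (st (l n)) := antitone_nat_of_succ_le fun n => (hnext n).2.1
  have hcof : ∀ γ < δ.1, ∃ n, γ < (tr (st (l n))).tree.height := fun γ hγ => by
    obtain ⟨n, rfl⟩ : γ ∈ Set.range e := he ▸ hγ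
    exact ⟨n + 1, (hnext n).2.2⟩
  refine ⟨fun n => st (l n), rfl, hI, fun n => (hnext n).1, hanti, δ, hδE,
    fun n => hδ _ (hmem n), unionCond _ hanti, unionCond_le _ hanti, le_antisymm ?_ ?_, ?_, hcof⟩
  · refine le_of_forall_lt fun γ hγ => ?_
    obtain ⟨n, hn⟩ := lt_height_unionCond _ hanti hγ
    exact hn.trans (hδ _ (hmem n))
  · refine le_of_forall_lt fun γ hγ => ?_
    obtain ⟨n, hn⟩ := hcof γ hγ
    exact hn.trans_le (height_mono (unionCond_le _ hanti n))
  · exact fun x hx => Set.mem_iUnion.1 hx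

end TreeForcing

/-- A condition of the iteration in which the second coordinate is decided: a tree together with
one of its nodes. -/
structure PairCond (S : Set Omega1) (f : CountableTree → CountableTree) where
  cond : TreeForcing S f
  node : Node
  mem : node ∈ cond.tree.carrier

namespace PairCond

open TreeForcing

variable {S : Set Omega1} {f : CountableTree → CountableTree}

instance instPreorder : Preorder (PairCond S f) where
  le p q := p.cond ≤ q.cond ∧ p.cond.tree.Le q.node p.node
  le_refl p := ⟨le_rfl, Le.refl _⟩
  le_trans p q r hpq hqr := ⟨hpq.1.trans hqr.1, (EndExt.le hpq.1 hqr.2).trans hpq.2⟩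

/-- The same node in a larger tree. -/
def lift (p : PairCond S f) {T : TreeForcing S f} (h : T ≤ p.cond) : PairCond S f :=
  ⟨T, p.node, carrier_mono h p.mem⟩

theorem lift_le (p : PairCond S f) {T : TreeForcing S f} (h : T ≤ p.cond) : p.lift h ≤ p :=
  ⟨h, Le.refl _⟩

theorem exists_level_ge (hf : IsMandatoryExtension f) (p : PairCond S f) {α : Ordinal.{0}}
    (hα : α < ω_ 1) : ∃ q ≤ p, α ≤ q.cond.tree.level q.node := by
  obtain ⟨T, hT, h⟩ := TreeForcing.exists_height_gt hf hα p.cond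
  obtain ⟨y, hy, hxy, hlev⟩ := T.extendible.exists_ge _ (carrier_mono hT p.mem) h
  exact ⟨⟨T, y, hy⟩, ⟨hT, hxy⟩, hlev⟩

theorem exists_forall_le {D : ℕ → Set (PairCond S f)} (hD : ∀ n, IsLowerSet (D n))
    {T : TreeForcing S f} (hd : ∀ n, ∀ p : PairCond S f, p.cond ≤ T → ∃ q ≤ p, q ∈ D n)
    (n : ℕ) (p : PairCond S f) (hp : p.cond ≤ T) : ∃ q ≤ p, ∀ i ≤ n, q ∈ D i := by
  induction n with
  | zero =>
    obtain ⟨q, hq, h⟩ := hd 0 p hp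
    exact ⟨q, hq, fun i hi => by rwa [Nat.le_zero.1 hi]⟩
  | succ n ih =>
    obtain ⟨q, hq, h⟩ := ih
    obtain ⟨r, hr, h'⟩ := hd (n + 1) q (hq.1.trans hp)
    refine ⟨r, hr.trans hq, fun i hi => ?_⟩
    rcases Nat.le_succ_iff.1 hi with hi | rfl
    · exact hD i hr (h i hi)
    · exact h'

/-- Every tree has an extension of limit height not in `S` in which the cofinal branches meeting
given countably many open dense sets cover the tree. -/
theorem exists_limit (hf : IsMandatoryExtension f) (hS : IsStationary Sᶜ)
    {D : ℕ → Set (PairCond S f)} (hD : ∀ n, IsLowerSet (D n)) (T : TreeForcing S f)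
    (hd : ∀ n, ∀ p : PairCond S f, p.cond ≤ T → ∃ q ≤ p, q ∈ D n) :
    ∃ U ≤ T, ∃ δ : Omega1, (∀ β ∈ S, β.1 ≠ U.tree.height) ∧ U.tree.height = δ.1 ∧
      ∃ b : ℕ → Set Node, (∀ k, U.tree.IsCofinalBranch (b k)) ∧
        (∀ x ∈ U.tree.carrier, ∃ k, x ∈ b k) ∧
        ∀ k n, ∃ p ∈ D n, p.cond = U ∧ p.node ∈ b k := by
  -- At step `n` every node of the current tree gets a node above it in the next tree, at a level
  -- not below the current height, that lies in `D 0, …, D n`. The countably many nodes can be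
  -- treated one after another because enlarging the tree preserves what was achieved.
  obtain ⟨s, rfl, hI, hR, hanti, δ, hδ, hlt, U, hU, hUδ, hUc, hcof⟩ := exists_targeted (S := S) (f := f)
    (σ := TreeForcing S f) id (fun _ s => s ≤ T)
    (fun n s s' => ∀ x ∈ s.tree.carrier, ∃ p : PairCond S f, p.cond = s' ∧
      s'.tree.Le x p.node ∧ s.tree.height ≤ s'.tree.level p.node ∧ ∀ i ≤ n, p ∈ D i)
    (by
      intro n s hs α hα
      have hβ : max α s.tree.height < ω_ 1 := max_lt hα s.tree.height_lt_omega_one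
      obtain ⟨T₁, hT₁, hh⟩ := exists_height_gt hf hβ s
      have := s.tree.countable.to_subtype
      obtain ⟨T₂, hT₂, h⟩ := (isSigmaClosed S f).exists_forall (ι := s.tree.carrier)
        (R := fun x T' => ∃ p : PairCond S f, p.cond = T' ∧
          T'.tree.Le x.1 p.node ∧ s.tree.height ≤ T'.tree.level p.node ∧ ∀ i ≤ n, p ∈ D i)
        (by
          rintro x _ T'' hle ⟨p, rfl, h1, h2, h3⟩
          refine ⟨p.lift hle, rfl, EndExt.le hle h1, ?_, fun i hi => hD i (p.lift_le hle) (h3 i hi)⟩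
          rw [EndExt.level_eq hle p.mem] at h2
          exact h2) T₁
        (by
          intro x T' hT'
          have hx : x.1 ∈ T'.tree.carrier := carrier_mono (hT'.trans hT₁) x.2
          obtain ⟨y, hy, hxy, hlev⟩ := T'.extendible.exists_ge _ hx
            (((le_max_right _ _).trans_lt hh).trans_le (height_mono hT'))
          obtain ⟨q, hq, hqD⟩ := exists_forall_le hD hd n ⟨T', y, hy⟩ ((hT'.trans hT₁).trans hs)
          refine ⟨q.cond, hq.1, q, rfl, (EndExt.le hq.1 hxy).trans hq.2, ?_, hqD⟩
          rw [EndExt.level_eq hq.1 hy] at hlev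
          exact hlev.trans hq.2.level_le)
      exact ⟨T₂, (hT₂.trans hT₁).trans hs, fun x hx => h ⟨x, hx⟩, hT₂.trans hT₁,
        ((le_max_left _ _).trans_lt hh).trans_le (height_mono hT₂)⟩)
    hS T le_rfl
  have hbr : ∀ x ∈ U.tree.carrier, ∃ b, U.tree.IsCofinalBranch b ∧ x ∈ b ∧
      ∀ n, ∃ p ∈ D n, p.cond = U ∧ p.node ∈ b := by
    intro x hx
    obtain ⟨k, hk⟩ := hUc x hx
    have hR' : ∀ (n : ℕ) (x : (s n).tree.carrier), ∃ y : (s (n + 1)).tree.carrier,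
        U.tree.Le x y ∧ (s n).tree.height ≤ U.tree.level y ∧
        ∀ i ≤ n, ∃ p ∈ D i, p.cond = U ∧ p.node = y := by
      rintro n ⟨x, hx⟩
      obtain ⟨p, hp1, hp2, hp3, hp4⟩ := hR n x hx
      have hle : U ≤ p.cond := hp1 ▸ hU (n + 1)
      have hmem : p.node ∈ (s (n + 1)).tree.carrier := hp1 ▸ p.mem
      refine ⟨⟨p.node, hmem⟩, EndExt.le (hU (n + 1)) hp2, ?_,
        fun i hi => ⟨p.lift hle, hD i (p.lift_le hle) (hp4 i hi), rfl, rfl⟩⟩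
      have := EndExt.level_eq (hU (n + 1)) hmem
      exact hp3.trans this.le
    choose nx hnx1 hnx2 hnx3 using hR'
    -- The branch starts at the stage `k` where `x` appears. Nothing is lost by this: stage `k + n`
    -- takes care of all `D i` with `i ≤ k + n`, in particular of `D n`.
    let u : ∀ n, (s (k + n)).tree.carrier := fun n => Nat.rec ⟨x, hk⟩ (fun n y => nx (k + n) y) n
    have hu : ∀ n, u (n + 1) = nx (k + n) (u n) := fun n => rfl
    refine ⟨U.tree.branchOf (fun n => (u n).1), U.tree.isCofinalBranch_branchOf
      (fun n => carrier_mono (hU (k + n)) (u n).2) (fun n => hnx1 (k + n) (u n)) ?_,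
      ⟨0, Or.inr rfl⟩, fun n => ?_⟩
    · intro γ hγ
      obtain ⟨m, hm⟩ := hcof γ (hUδ ▸ hγ)
      exact ⟨m + 1, (hm.trans_le ((height_mono (hanti (Nat.le_add_left m k))).trans
        (hnx2 (k + m) (u m)))).le⟩
    · obtain ⟨p, hp, hpU, hpn⟩ := hnx3 (k + n) (u n) n (Nat.le_add_left n k)
      exact ⟨p, hp, hpU, n + 1, Or.inr hpn⟩
  have hne : U.tree.carrier.Nonempty := by
    obtain ⟨x, hx, -⟩ := U.tree.exists_level_eq (γ := (s 0).tree.height) (hUδ ▸ hlt 0)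
    exact ⟨x, hx⟩
  obtain ⟨e, he⟩ := U.tree.countable.exists_eq_range hne
  choose b hb1 hb2 hb3 using fun n => hbr (e n) (he ▸ ⟨n, rfl⟩)
  refine ⟨U, hU 0, δ, fun β hβ h => hδ ?_, hUδ, b, hb1, fun x hx => ?_, fun k n => hb3 k n⟩
  · rwa [← Subtype.ext (h.trans hUδ)]
  · obtain ⟨n, rfl⟩ : x ∈ Set.range e := he ▸ hx
    exact ⟨n, hb2 n⟩

/-- Every tree has an extension with a top level all of whose nodes decide as prescribed by
countably many given open dense sets. -/
theorem exists_sealed (hf : IsMandatoryExtension f) (hS : IsStationary Sᶜ)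
    {D : ℕ → Set (PairCond S f)} (hD : ∀ n, IsLowerSet (D n)) (T : TreeForcing S f)
    (hd : ∀ n, ∀ p : PairCond S f, p.cond ≤ T → ∃ q ≤ p, q ∈ D n) :
    ∃ U ≤ T, ∃ δ : Omega1, U.tree.height = δ.1 + 1 ∧
      (∀ p : PairCond S f, p.cond = U → U.tree.level p.node = δ.1 → ∀ n, p ∈ D n) ∧
      ∀ x ∈ T.tree.carrier, ∃ y z, U.tree.lt x y ∧ U.tree.lt x z ∧ y ≠ z ∧
        U.tree.level y = δ.1 ∧ U.tree.level z = δ.1 := by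
  obtain ⟨U, hU, δ, hδ, hUδ, b, hb, hcov, hbD⟩ := exists_limit hf hS hD T hd
  obtain ⟨g, hg, hgT⟩ := U.tree.exists_fresh
  -- Each branch gets two top nodes, with indices `2 * n` and `2 * n + 1`; this yields the splitting
  -- in the last clause. No other branch is continued, so every top node is above members of all `D
  -- n`.
  obtain ⟨V, hVU, hVh, hVc, hlt, hlev⟩ := exists_addTop U (fun n => b (n / 2)) (fun n => hb _) g hg
    hgT (fun x hx => by
      obtain ⟨n, hn⟩ := hcov x hx
      exact ⟨2 * n, by simpa using hn⟩) hδ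
  rw [hUδ] at hVh hlev
  refine ⟨V, hVU.trans hU, δ, hVh, ?_, ?_⟩
  · rintro p hp hpl n
    have hpm : p.node ∈ V.tree.carrier := hp ▸ p.mem
    rcases (hVc _).1 hpm with hpm | ⟨m, hm⟩
    · rw [← EndExt.level_eq hVU hpm, ← hUδ] at hpl
      exact absurd hpl (U.tree.level_lt_height hpm).ne
    · obtain ⟨q, hq, hqU, hqb⟩ := hbD (m / 2) n
      refine hD n (show p ≤ q from ⟨by rw [hp, hqU]; exact hVU, ?_⟩) hq
      rw [hp, ← hm]
      exact Or.inl ((hlt _ _).2 hqb)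
  · intro x hx
    obtain ⟨n, hn⟩ := hcov x (carrier_mono hU hx)
    refine ⟨g (2 * n), g (2 * n + 1), (hlt _ _).2 (by simpa using hn), (hlt _ _).2 ?_,
      fun h => by simpa using hg h, hlev _, hlev _⟩
    rwa [show (2 * n + 1) / 2 = n by omega]

end PairCond

end CutChoose

/-! ### Forcing through dense presentations; the generic tree is Souslin -/

namespace CutChoose

/-- `i : D → B` presents the forcing notion `D` as a dense subset of `B`. -/
structure IsDensePresentation {D B : Type*} [Preorder D] [CompleteBooleanAlgebra B]
    (i : D → B) : Prop where
  mono : Monotone i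
  ne_bot : ∀ d, i d ≠ ⊥
  dense : ∀ b, b ≠ ⊥ → ∃ d, i d ≤ b
  compat : ∀ d d', i d ⊓ i d' ≠ ⊥ → ∃ e, e ≤ d ∧ e ≤ d'

namespace IsDensePresentation

variable {D B : Type*} [Preorder D] [CompleteBooleanAlgebra B] {i : D → B}
  (h : IsDensePresentation i)
include h

/-- Density yields `e` with `i e` below the meet, but `i` need not reflect the order; compatibility
replaces `e` by a condition that really is below `d`. -/
theorem exists_le {d : D} {b : B} (hb : i d ⊓ b ≠ ⊥) : ∃ d' ≤ d, i d' ≤ b := by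
  obtain ⟨e, he⟩ := h.dense _ hb
  have : i d ⊓ i e ≠ ⊥ := by
    rw [inf_eq_right.2 (he.trans inf_le_left)]
    exact h.ne_bot e
  obtain ⟨d', h1, h2⟩ := h.compat _ _ this
  exact ⟨d', h1, (h.mono h2).trans (he.trans inf_le_right)⟩

theorem le_of_dense {d : D} {b : B} (hb : ∀ d' ≤ d, ∃ d'' ≤ d', i d'' ≤ b) : i d ≤ b := by
  by_contra hle
  rw [← disjoint_compl_right_iff, disjoint_iff] at hle
  obtain ⟨d', hd', h1⟩ := h.exists_le hle
  obtain ⟨d'', hd'', h2⟩ := hb d' hd'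
  exact h.ne_bot d'' (le_bot_iff.1 (inf_compl_eq_bot (a := b) ▸ le_inf h2 ((h.mono hd'').trans h1)))

theorem le_of_forall {a b : B} (hab : ∀ d, i d ≤ a → ∃ d' ≤ d, i d' ≤ b) : a ≤ b := by
  by_contra hle
  rw [← disjoint_compl_right_iff, disjoint_iff] at hle
  obtain ⟨d, hd⟩ := h.dense _ hle
  obtain ⟨d', hd', h2⟩ := hab d (hd.trans inf_le_left)
  exact h.ne_bot d' (le_bot_iff.1 (inf_compl_eq_bot (a := b) ▸
    le_inf h2 ((h.mono hd').trans (hd.trans inf_le_right))))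

/-- The forcing clause for existential statements: an element meeting a supremum meets one of its
terms, so a witness is decided densely below `d`. -/
theorem le_iSup_iff {ι : Sort*} {d : D} {b : ι → B} :
    i d ≤ ⨆ k, b k ↔ ∀ d' ≤ d, ∃ d'' ≤ d', ∃ k, i d'' ≤ b k := by
  constructor
  · intro hle d' hd'
    have : i d' ⊓ ⨆ k, b k ≠ ⊥ := by
      rw [inf_eq_left.2 ((h.mono hd').trans hle)]
      exact h.ne_bot d'
    rw [inf_iSup_eq, Ne, iSup_eq_bot, not_forall] at this
    obtain ⟨k, hk⟩ := this
    obtain ⟨d'', h1, h2⟩ := h.exists_le hk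
    exact ⟨d'', h1, k, h2⟩
  · intro H
    refine h.le_of_dense fun d' hd' => ?_
    obtain ⟨d'', h1, k, h2⟩ := H d' hd'
    exact ⟨d'', h1, h2.trans (le_iSup b k)⟩

theorem exists_le_sup {d : D} {a b : B} (hle : i d ≤ a ⊔ b) : ∃ d' ≤ d, i d' ≤ a ∨ i d' ≤ b := by
  rw [sup_eq_iSup, h.le_iSup_iff] at hle
  obtain ⟨d', hd', k, hk⟩ := hle d le_rfl
  cases k
  · exact ⟨d', hd', Or.inr hk⟩
  · exact ⟨d', hd', Or.inl hk⟩

theorem le_compl_iff {d : D} {b : B} : i d ≤ bᶜ ↔ ∀ d' ≤ d, ¬ i d' ≤ b := by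
  constructor
  · intro hle d' hd' hb
    exact h.ne_bot d' (le_bot_iff.1 (inf_compl_eq_bot (a := b) ▸
      le_inf hb ((h.mono hd').trans hle)))
  · intro H
    by_contra hle
    rw [← disjoint_compl_right_iff, disjoint_iff, compl_compl] at hle
    obtain ⟨d', hd', h1⟩ := h.exists_le hle
    exact H d' hd' h1

theorem not_le_of_le_compl {d : D} {b : B} (hd : i d ≤ bᶜ) : ¬ i d ≤ b :=
  h.le_compl_iff.1 hd d le_rfl

end IsDensePresentation

section RegularOpen

variable {P : Type*} [Preorder P]

/-- The regular open set generated by a condition. -/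
def principal (p : P) : RO P := Heyting.Regular.toRegular (LowerSet.Iic p)

theorem principal_le_iff {p : P} {b : RO P} : principal p ≤ b ↔ p ∈ (b : LowerSet P) := by
  rw [principal, ((Heyting.Regular.gi (α := LowerSet P)).gc _ _), LowerSet.Iic_le]

theorem mem_compl_iff {p : P} {a : LowerSet P} : p ∈ aᶜ ↔ ∀ q ≤ p, q ∉ a := by
  rw [← LowerSet.Iic_le, le_compl_iff_disjoint_right, disjoint_iff_inf_le]
  exact ⟨fun h q hq hqa => h ⟨hq, hqa⟩, fun h q hq => h q hq.1 hq.2⟩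

theorem mem_toRegular_iff {p : P} {a : LowerSet P} :
    p ∈ (Heyting.Regular.toRegular a : LowerSet P) ↔ ∀ q ≤ p, ∃ r ≤ q, r ∈ a := by
  rw [Heyting.Regular.coe_toRegular, mem_compl_iff]
  refine forall₂_congr fun q _ => ?_
  rw [mem_compl_iff]
  push Not
  rfl

theorem principal_le_toRegular_iff {p : P} {a : LowerSet P} :
    principal p ≤ Heyting.Regular.toRegular a ↔ ∀ q ≤ p, ∃ r ≤ q, r ∈ a := by
  rw [principal_le_iff, mem_toRegular_iff]

variable (P) in
theorem isDensePresentation_principal : IsDensePresentation (principal (P := P)) where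
  mono p q hpq := principal_le_iff.2
    ((principal q : LowerSet P).lower hpq (principal_le_iff.1 le_rfl))
  ne_bot p hp := by
    have h : p ∈ ((⊥ : RO P) : LowerSet P) := principal_le_iff.1 hp.le
    exact h
  dense b hb := by
    by_contra! H
    refine hb (le_bot_iff.1 fun p hp => ?_)
    exact absurd (principal_le_iff.2 hp) (H p)
  compat p q h := by
    by_contra! H
    refine h (le_bot_iff.1 fun r hr => ?_)
    obtain ⟨r', hr', h1⟩ := mem_toRegular_iff.1 hr.1 r le_rfl
    obtain ⟨r'', hr'', h2⟩ := mem_toRegular_iff.1 hr.2 r' hr'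
    exact absurd h2 (H r'' (hr''.trans h1))

end RegularOpen

open Classical in
/-- The canonical name for `x`. -/
noncomputable def checkName {B X : Type*} [CompleteBooleanAlgebra B] (x : X) (y : X) : B :=
  if y = x then ⊤ else ⊥

theorem isElementName_checkName {B X : Type*} [CompleteBooleanAlgebra B] (x : X) :
    IsElementName (checkName x : X → B) := by
  refine ⟨fun y z hyz => ?_, top_le_iff.1 (le_iSup_of_le x (by simp [checkName]))⟩
  by_cases hy : y = x
  · have hz : z ≠ x := fun h => hyz (hy.trans h.symm)
    simp [checkName, hz]
  · simp [checkName, hy]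

/-- An enumeration of the ground-model set `W` by canonical names is the witness; one arbitrary
element is added only to have something to enumerate when `W` is empty. -/
theorem le_countableValue {B X : Type*} [CompleteBooleanAlgebra B] [Nonempty X] {A : X → B} {b : B}
    {W : Set X} (hW : W.Countable) (h : ∀ x, x ∉ W → b ≤ (A x)ᶜ) : b ≤ countableValue A := by
  obtain ⟨e, he⟩ := (hW.union (Set.countable_singleton (Classical.arbitrary X))).exists_eq_range
    ⟨_, Or.inr rfl⟩
  refine le_iSup_of_le ⟨fun n => checkName (e n), fun n => isElementName_checkName _⟩
    (le_iInf fun x => ?_)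
  by_cases hx : x ∈ W
  · obtain ⟨n, rfl⟩ : x ∈ Set.range e := he ▸ Or.inl hx
    rw [le_himp_iff]
    exact le_iSup_of_le n (by simp [checkName])
  · exact (h x hx).trans (by rw [himp_eq]; exact le_sup_right)

open CountableTree

namespace TreeForcing

variable {S : Set Omega1} {f : CountableTree → CountableTree}

theorem principal_le_genericMem {T : TreeForcing S f} {x : Node} (hx : x ∈ T.tree.carrier) :
    principal T ≤ genericMem S f x :=
  principal_le_toRegular_iff.2 fun q hq => ⟨q, le_rfl, carrier_mono hq hx⟩

theorem exists_mem {T : TreeForcing S f} {x : Node} (h : principal T ≤ genericMem S f x) :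
    ∃ T' ≤ T, x ∈ T'.tree.carrier :=
  principal_le_toRegular_iff.1 h T le_rfl

theorem principal_le_genericLt {T : TreeForcing S f} {x y : Node} (hxy : T.tree.lt x y) :
    principal T ≤ genericLt S f x y :=
  principal_le_toRegular_iff.2 fun q hq => ⟨q, le_rfl, lt_mono hq hxy⟩

theorem exists_lt {T : TreeForcing S f} {x y : Node} (h : principal T ≤ genericLt S f x y) :
    ∃ T' ≤ T, T'.tree.lt x y :=
  principal_le_toRegular_iff.1 h T le_rfl

variable (S f) in
theorem treeValue_eq_top : treeValue (genericMem S f) (genericLt S f) = ⊤ := by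
  have H := isDensePresentation_principal (TreeForcing S f)
  refine top_le_iff.1 (le_inf (le_inf (le_inf (le_inf ?_ ?_) ?_) ?_) ?_)
  · exact le_iInf fun x => le_iInf fun y => le_himp_iff.2 (inf_le_right.trans (genericLt_le S f x y))
  · refine le_iInf fun x => H.le_of_forall fun T _ => ⟨T, le_rfl, H.le_compl_iff.2 ?_⟩
    intro T' _ h
    obtain ⟨T'', _, h⟩ := exists_lt h
    exact T''.tree.not_lt_self x h
  · exact le_iInf fun x => le_iInf fun y => le_iInf fun z =>
      le_himp_iff.2 (inf_le_right.trans (genericLt_trans S f x y z))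
  · refine le_iInf fun x => le_iInf fun y => le_iInf fun z => le_iInf fun hxy =>
      le_himp_iff.2 (inf_le_right.trans (H.le_of_forall fun T hT => ?_))
    obtain ⟨T₁, h₁, hx⟩ := exists_lt (hT.trans inf_le_left)
    obtain ⟨T₂, h₂, hy⟩ := exists_lt ((H.mono h₁).trans (hT.trans inf_le_right))
    refine ⟨T₂, h₂.trans h₁, ?_⟩
    rcases T₂.tree.trichotomy_of_lt (lt_mono h₂ hx) hy with h | h | h
    · exact (principal_le_genericLt h).trans le_sup_left
    · exact absurd h hxy
    · exact (principal_le_genericLt h).trans le_sup_right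
  · refine le_iInf fun A => le_himp_iff.2 (inf_le_right.trans (H.le_of_forall fun T hT => ?_))
    obtain ⟨T₁, h₁, x, hx⟩ := H.le_iSup_iff.1 (hT.trans inf_le_right) T le_rfl
    have hsub := ((H.mono h₁).trans (hT.trans inf_le_left)).trans (iInf_le _ x)
    obtain ⟨T₂, h₂, hxm⟩ := exists_mem ((le_inf hsub hx).trans himp_inf_le)
    -- Among the nodes up to `x` that some extension of `T₂` forces into `A`, one of minimal level
    -- is taken. Nodes of `T₂` acquire no new predecessors, so well-foundedness in the ground model
    -- suffices.
    obtain ⟨z, ⟨⟨T₃, h₃, hz⟩, hzx⟩, hmin⟩ := WellFounded.has_min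
      (InvImage.wf T₂.tree.level Ordinal.lt_wf)
      {z | (∃ T' ≤ T₂, principal T' ≤ A z) ∧ T₂.tree.Le z x}
      ⟨x, ⟨T₂, le_rfl, (H.mono h₂).trans hx⟩, Le.refl x⟩
    refine ⟨T₃, h₃.trans (h₂.trans h₁), le_iSup_of_le z (le_inf hz (le_iInf fun y => ?_))⟩
    refine H.le_compl_iff.2 fun T₄ h₄ h => ?_
    obtain ⟨T₅, h₅, hyz⟩ := exists_lt (h.trans inf_le_right)
    have hyz' : T₂.tree.lt y z :=
      (EndExt.lt_iff (h₅.trans (h₄.trans h₃)) (hzx.mem_left hxm)).2 hyz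
    exact hmin y ⟨⟨T₄, h₄.trans h₃, h.trans inf_le_left⟩, Le.trans (Or.inl hyz') hzx⟩
      (T₂.tree.level_lt_level hyz')

/-- By `σ`-closure one condition decides a whole named sequence of nodes, and for each term either
contains it or excludes it from all extensions. The next mandatory level then has a node that is
none of them. -/
theorem compl_countableValue_eq_top (hf : IsMandatoryExtension f) :
    (countableValue (genericMem S f))ᶜ = ⊤ := by
  have H := isDensePresentation_principal (TreeForcing S f)
  refine top_le_iff.1 (H.le_of_forall fun T _ => ⟨T, le_rfl, H.le_compl_iff.2 fun T₁ _ h => ?_⟩)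
  obtain ⟨T₂, -, ⟨g, hg⟩, h⟩ := H.le_iSup_iff.1 h T₁ le_rfl
  obtain ⟨T₃, h₃, hx⟩ := (isSigmaClosed S f).exists_forall (R := fun n T => ∃ x, principal T ≤ g n x)
    (fun n T T' hT ⟨x, hx⟩ => ⟨x, (H.mono hT).trans hx⟩) T₂ fun n T _ =>
      H.le_iSup_iff.1 ((hg n).2 ▸ le_top) T le_rfl
  choose x hx using hx
  obtain ⟨T₄, h₄, hm⟩ := (isSigmaClosed S f).exists_forall
    (R := fun n T => x n ∈ T.tree.carrier ∨ ∀ T' ≤ T, x n ∉ T'.tree.carrier)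
    (fun n T T' hT hn => hn.imp (carrier_mono hT) fun hn T'' h => hn T'' (h.trans hT)) T₃
    (fun n T _ => by
      by_cases hc : ∃ T' ≤ T, x n ∈ T'.tree.carrier
      · obtain ⟨T', hT', hm⟩ := hc
        exact ⟨T', hT', Or.inl hm⟩
      · push Not at hc
        exact ⟨T, le_rfl, Or.inr hc⟩)
  obtain ⟨z, hz, hzl⟩ := (succCond hf T₄).tree.exists_level_eq (γ := T₄.tree.height) (by
    rw [height_succCond]; exact lt_add_one _)
  have hle := succCond_le hf T₄
  have hzn : z ∉ T₄.tree.carrier := fun hz' => by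
    have := T₄.tree.level_lt_height hz'
    rw [EndExt.level_eq hle hz', hzl] at this
    exact this.false
  have h' : principal (succCond hf T₄) ≤ ⨆ n, g n z :=
    (le_inf ((H.mono (hle.trans (h₄.trans h₃))).trans (h.trans (iInf_le _ z)))
      (principal_le_genericMem hz)).trans himp_inf_le
  obtain ⟨T₅, h₅, n, hn⟩ := H.le_iSup_iff.1 h' _ le_rfl
  have hne : x n ≠ z := by
    rintro rfl
    exact (hm n).elim hzn fun hm => hm _ hle hz
  refine H.ne_bot T₅ (le_bot_iff.1 ?_)
  rw [← (hg n).1 _ _ hne]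
  exact le_inf ((H.mono (h₅.trans (hle.trans h₄))).trans (hx n)) hn

/-- If the nodes of the sealing level force that no element of `A` lies above them, then `A` is
forced to be a subset of the sealed tree. -/
theorem le_compl_of_sealed {A : Node → RO (TreeForcing S f)} {T U : TreeForcing S f} {δ : Ordinal.{0}}
    (hT : principal T ≤ subsetValue (genericMem S f) A) (hU : U ≤ T) (hδ : U.tree.height = δ + 1)
    (h : ∀ p q : PairCond S f, p.cond = U → U.tree.level p.node = δ → q ≤ p → q.node ∉ U.tree.carrier →
      ¬ principal q.cond ≤ A q.node) (x : Node) (hx : x ∉ U.tree.carrier) :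
    principal U ≤ (A x)ᶜ := by
  have H := isDensePresentation_principal (TreeForcing S f)
  refine H.le_compl_iff.2 fun T₁ h₁ hA => ?_
  obtain ⟨T₂, h₂, hxm⟩ := exists_mem ((le_inf ((H.mono (h₁.trans hU)).trans
    (hT.trans (iInf_le _ x))) hA).trans himp_inf_le)
  have hlev : U.tree.height ≤ T₂.tree.level x := by
    by_contra hlt
    exact hx ((EndExt.mem_iff (h₂.trans h₁)).2 ⟨hxm, not_le.1 hlt⟩)
  have hδ' : δ < U.tree.height := hδ ▸ lt_add_one δ
  obtain ⟨y, hyx, hy⟩ := T₂.tree.exists_le_level_eq (hδ'.le.trans hlev)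
  have hyU : y ∈ U.tree.carrier :=
    (EndExt.mem_iff (h₂.trans h₁)).2 ⟨hyx.mem_left hxm, hy.symm ▸ hδ'⟩
  exact h ⟨U, y, hyU⟩ ⟨T₂, x, hxm⟩ rfl ((EndExt.level_eq (h₂.trans h₁) hyU).trans hy)
    ⟨h₂.trans h₁, hyx⟩ hx ((H.mono h₂).trans hA)

/-- Sealing a suitable dense set confines a chain or an antichain `A` to a countable tree. For
chains, the sealed nodes have no node of `A` at or above them. For antichains, each sealed node has
a node of `A` at or below it, or none at or above it; an element of `A` beyond the sealed level
contradicts both. -/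
theorem souslinValue_eq_top (hf : IsMandatoryExtension f) (hS : IsStationary Sᶜ) :
    souslinValue (genericMem S f) (genericLt S f) = ⊤ := by
  have H := isDensePresentation_principal (TreeForcing S f)
  have hne : Nonempty Node := by
    have := uncountable_node
    infer_instance
  refine top_le_iff.1 (le_inf (le_inf (le_inf (treeValue_eq_top S f).ge
    (compl_countableValue_eq_top hf).ge) ?_) ?_)
  · refine le_iInf fun A => le_himp_iff.2 (inf_le_right.trans (H.le_of_forall fun T hT => ?_))
    obtain ⟨U, hU, δ, hδ, hUD, -⟩ := PairCond.exists_sealed hf hS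
      (D := fun _ => {p | ∀ q ≤ p, ¬ principal q.cond ≤ A q.node})
      (fun _ p p' hp h q hq => h q (hq.trans hp)) T (by
        intro _ p hp
        obtain ⟨V, hV, γ, -, -, hs⟩ := PairCond.exists_sealed hf hS (D := fun _ => Set.univ)
          (fun _ => isLowerSet_univ) p.cond fun _ p _ => ⟨p, le_rfl, trivial⟩
        obtain ⟨y, z, hy, hz, hyz, hyl, hzl⟩ := hs p.node p.mem
        -- Two incomparable nodes lie above the given one. If an element of the chain appears above
        -- `y`, none can appear above `z`, since comparable elements would put `y` and `z` below a
        -- common node.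
        by_cases hc : ∃ q ≤ (⟨V, y, (V.tree.lt_mem hy).2⟩ : PairCond S f),
          principal q.cond ≤ A q.node
        · obtain ⟨q, hq, hqA⟩ := hc
          refine ⟨⟨q.cond, z, carrier_mono hq.1 (V.tree.lt_mem hz).2⟩,
            ⟨hq.1.trans hV, Or.inl (lt_mono hq.1 hz)⟩, ?_⟩
          intro q' hq' hq'A
          have key : ∀ T' ≤ V, ∀ w, T'.tree.Le y w → T'.tree.Le z w → False := by
            intro T' hT' w hyw hzw
            rw [EndExt.level_eq hT' (V.tree.lt_mem hy).2] at hyl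
            rw [EndExt.level_eq hT' (V.tree.lt_mem hz).2] at hzl
            rcases T'.tree.le_of_level_le hyw hzw (hyl.trans hzl.symm).le with h | h
            · exact (T'.tree.level_lt_level h).ne (hyl.trans hzl.symm)
            · exact hyz h
          have hy' : q'.cond.tree.Le y q.node := EndExt.le hq'.1 hq.2
          by_cases heq : q.node = q'.node
          · exact key _ (hq'.1.trans hq.1) q.node hy' (heq ▸ hq'.2)
          · have hch := ((H.mono ((hq'.1.trans (hq.1.trans hV)).trans hp)).trans
              (hT.trans inf_le_right)).trans ((iInf_le _ q.node).trans ((iInf_le _ q'.node).trans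
                (iInf_le _ heq)))
            obtain ⟨T', hT', h⟩ := H.exists_le_sup ((le_inf hch (le_inf ((H.mono hq'.1).trans hqA)
              hq'A)).trans himp_inf_le)
            rcases h with h | h
            · obtain ⟨T'', hT'', h⟩ := exists_lt h
              have hle := hT''.trans hT'
              exact key T'' (hle.trans (hq'.1.trans hq.1)) q'.node
                ((EndExt.le hle hy').trans (Or.inl h)) (EndExt.le hle hq'.2)
            · obtain ⟨T'', hT'', h⟩ := exists_lt h
              have hle := hT''.trans hT'
              exact key T'' (hle.trans (hq'.1.trans hq.1)) q.node
                (EndExt.le hle hy') ((EndExt.le hle hq'.2).trans (Or.inl h))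
        · push Not at hc
          exact ⟨_, ⟨hV, Or.inl hy⟩, hc⟩)
    refine ⟨U, hU, le_countableValue U.tree.countable (le_compl_of_sealed (hT.trans inf_le_left)
      hU hδ ?_)⟩
    intro p q hp hpl hq _
    exact hUD p hp hpl 0 q hq
  · refine le_iInf fun A => le_himp_iff.2 (inf_le_right.trans (H.le_of_forall fun T hT => ?_))
    obtain ⟨U, hU, δ, hδ, hUD, -⟩ := PairCond.exists_sealed hf hS
      (D := fun _ => {p | (∃ z, principal p.cond ≤ A z ∧ p.cond.tree.Le z p.node) ∨
        ∀ q ≤ p, ¬ principal q.cond ≤ A q.node})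
      (fun _ p p' hp h => h.imp (fun ⟨z, hz, hzp⟩ => ⟨z, (H.mono hp.1).trans hz,
        (EndExt.le hp.1 hzp).trans hp.2⟩) fun h q hq => h q (hq.trans hp)) T (by
        intro _ p hp
        by_cases hc : ∃ q ≤ p, principal q.cond ≤ A q.node
        · obtain ⟨q, hq, hqA⟩ := hc
          exact ⟨q, hq, Or.inl ⟨q.node, hqA, Le.refl _⟩⟩
        · push Not at hc
          exact ⟨p, le_rfl, Or.inr hc⟩)
    refine ⟨U, hU, le_countableValue U.tree.countable (le_compl_of_sealed (hT.trans inf_le_left)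
      hU hδ ?_)⟩
    intro p q hp hpl hq hqU hqA
    rcases hUD p hp hpl 0 with ⟨z, hz, hzp⟩ | h
    · have hlt : q.cond.tree.Le z q.node := (EndExt.le hq.1 hzp).trans hq.2
      have hzU : z ∈ U.tree.carrier := hp ▸ hzp.mem_left p.mem
      rcases hlt with hlt | rfl
      · have hzq : z ≠ q.node := fun h => q.cond.tree.not_lt_self z (h ▸ hlt)
        have hac := ((H.mono ((hp ▸ hq.1 : q.cond ≤ U).trans hU)).trans
          (hT.trans inf_le_right)).trans ((iInf_le _ z).trans ((iInf_le _ q.node).trans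
            (iInf_le _ hzq)))
        exact H.not_le_of_le_compl ((le_inf hac (le_inf ((H.mono hq.1).trans hz)
          hqA)).trans himp_inf_le) ((principal_le_genericLt hlt).trans le_sup_left)
      · exact hqU hzU
    · exact h q hq hqA

end TreeForcing

end CutChoose

/-! ### The iteration: decided pairs are dense; distributivity and bounded names -/

namespace CutChoose

open CountableTree TreeForcing

namespace PairCond

variable {S : Set Omega1} {f : CountableTree → CountableTree}

theorem eq_of_le_checkName {B X : Type*} [CompleteBooleanAlgebra B] {b : B} (hb : b ≠ ⊥) {x y : X}
    (h : b ≤ checkName x y) : y = x := by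
  by_contra hne
  rw [checkName, if_neg hne, le_bot_iff] at h
  exact hb h

/-- The condition of the two-step iteration given by a tree and one of its nodes. -/
noncomputable def toTwoStep (p : PairCond S f) : MandatoryIteration S f where
  fst := p.cond
  snd := checkName p.node
  isName := isElementName_checkName _
  forces_mem := principal_le_iff.1 (le_iSup_of_le p.node
    (le_inf (by simp [checkName]) (principal_le_genericMem p.mem)))

/-- End-extensions leave the predecessors of `p.node` unchanged, so a comparison that is forced
already holds in `p.cond`. -/
theorem toTwoStep_le_iff {p q : PairCond S f} : p.toTwoStep ≤ q.toTwoStep ↔ p ≤ q := by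
  have H := isDensePresentation_principal (TreeForcing S f)
  refine and_congr_right fun hle => ?_
  change Forces p.cond _ ↔ _
  rw [Forces, ← principal_le_iff, NamedPreorder.nameLe]
  constructor
  · intro h
    obtain ⟨T₁, h₁, x, h⟩ := H.le_iSup_iff.1 h _ le_rfl
    obtain ⟨T₂, h₂, y, h⟩ := H.le_iSup_iff.1 h _ le_rfl
    obtain rfl := eq_of_le_checkName (H.ne_bot _) (h.trans (inf_le_left.trans inf_le_left))
    obtain rfl := eq_of_le_checkName (H.ne_bot _) (h.trans (inf_le_left.trans inf_le_right))
    obtain ⟨T₃, h₃, h | h⟩ := H.exists_le_sup (h.trans inf_le_right)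
    · obtain ⟨T₄, h₄, h⟩ := exists_lt h
      exact Or.inl ((EndExt.lt_iff (h₄.trans (h₃.trans (h₂.trans h₁))) p.mem).2 h)
    · split_ifs at h with heq
      · exact Or.inr heq.symm
      · exact absurd (le_bot_iff.1 h) (H.ne_bot _)
  · intro h
    refine le_iSup_of_le p.node (le_iSup_of_le q.node
      (le_inf (by simp [toTwoStep, checkName]) ?_))
    rcases h with h | h
    · exact (principal_le_genericLt h).trans le_sup_left
    · refine le_trans ?_ le_sup_right
      rw [if_pos h.symm]
      exact principal_le_genericMem p.mem

/-- Extending the first coordinate decides the value of the name in the second one and makes that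
value a node of the tree. -/
theorem exists_toTwoStep_le (c : MandatoryIteration S f) : ∃ p : PairCond S f, p.toTwoStep ≤ c := by
  have H := isDensePresentation_principal (TreeForcing S f)
  obtain ⟨T₁, h₁, x, hx⟩ := H.le_iSup_iff.1 (principal_le_iff.2 c.forces_mem) _ le_rfl
  obtain ⟨T₂, h₂, hm⟩ := exists_mem (hx.trans inf_le_right)
  refine ⟨⟨T₂, x, hm⟩, h₂.trans h₁, principal_le_iff.1 ?_⟩
  refine le_iSup_of_le x (le_iSup_of_le x (le_inf (le_inf ?_ ?_) ?_))
  · simp [toTwoStep, checkName]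
  · exact (H.mono h₂).trans (hx.trans inf_le_left)
  · exact ((H.mono h₂).trans (hx.trans inf_le_right)).trans ((genericTree S f).refl x)

variable (S f) in
theorem isDensePresentation :
    IsDensePresentation fun p : PairCond S f => principal p.toTwoStep where
  mono p q h := (isDensePresentation_principal _).mono (toTwoStep_le_iff.2 h)
  ne_bot p := (isDensePresentation_principal _).ne_bot _
  dense b hb := by
    obtain ⟨c, hc⟩ := (isDensePresentation_principal _).dense b hb
    obtain ⟨p, hp⟩ := exists_toTwoStep_le c
    exact ⟨p, ((isDensePresentation_principal _).mono hp).trans hc⟩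
  compat p q h := by
    obtain ⟨c, hc⟩ := (isDensePresentation_principal _).compat _ _ h
    obtain ⟨r, hr⟩ := exists_toTwoStep_le c
    exact ⟨r, toTwoStep_le_iff.1 (hr.trans hc.1), toTwoStep_le_iff.1 (hr.trans hc.2)⟩

variable {B : Type*} [CompleteBooleanAlgebra B] {i : PairCond S f → B}

/-- The `n`-th sealed set consists of the pairs that select some `a n k` or exclude all of them. A
sealed node above that of `p` decides for all `n` together, and exclusion is impossible below `p`.
-/
theorem isAleph0Distributive {B : Type} [CompleteBooleanAlgebra B] {i : PairCond S f → B}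
    (H : IsDensePresentation i) (hf : IsMandatoryExtension f)
    (hS : IsStationary Sᶜ) : IsAleph0Distributive B := by
  intro I a
  refine le_antisymm (H.le_of_forall fun p hp => ?_)
    (iSup_le fun g => iInf_mono fun n => le_iSup (a n) (g n))
  obtain ⟨U, hU, δ, hδ, hUD, hs⟩ := exists_sealed hf hS
    (D := fun n => {q | (∃ k, i q ≤ a n k) ∨ i q ≤ (⨆ k, a n k)ᶜ})
    (fun n q r hr h => h.imp (fun ⟨k, hk⟩ => ⟨k, (H.mono hr).trans hk⟩) (H.mono hr).trans) p.cond (by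
      intro n q _
      by_cases hc : ∃ r ≤ q, i r ≤ ⨆ k, a n k
      · obtain ⟨r, hr, h⟩ := hc
        obtain ⟨r', hr', h⟩ := H.le_iSup_iff.1 h r le_rfl
        exact ⟨r', hr'.trans hr, Or.inl h⟩
      · push Not at hc
        exact ⟨q, le_rfl, Or.inr (H.le_compl_iff.2 hc)⟩)
  obtain ⟨y, -, hy, -, -, hyl, -⟩ := hs p.node p.mem
  let q : PairCond S f := ⟨U, y, (U.tree.lt_mem hy).2⟩
  have hq : q ≤ p := ⟨hU, Or.inl hy⟩
  have : ∀ n, ∃ k, i q ≤ a n k := fun n => (hUD q rfl hyl n).resolve_right fun h =>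
    H.not_le_of_le_compl h ((H.mono hq).trans (hp.trans (iInf_le _ n)))
  choose g hg using this
  exact ⟨q, hq, le_iSup_of_le g (le_iInf hg)⟩

/-- Over a sealed level, a name for an element is decided up to countably many values. -/
theorem exists_countable_values (H : IsDensePresentation i) (hf : IsMandatoryExtension f)
    (hS : IsStationary Sᶜ) {X : Type*} {a : X → B} (ha : IsElementName a) (T : TreeForcing S f) :
    ∃ U ≤ T, ∃ C : Set X, C.Countable ∧ ∀ p : PairCond S f, p.cond ≤ U → i p ≤ ⨆ y ∈ C, a y := by
  obtain ⟨U, hU, δ, hδ, hUD, -⟩ := exists_sealed hf hS (D := fun _ => {q | ∃ y, i q ≤ a y})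
    (fun _ q r hr ⟨y, hy⟩ => ⟨y, (H.mono hr).trans hy⟩) T
    (fun _ q _ => H.le_iSup_iff.1 (ha.2 ▸ le_top) q le_rfl)
  have := U.tree.countable.to_subtype
  have hch : ∀ x : U.tree.carrier, ∃ y, U.tree.level x = δ.1 → i ⟨U, x.1, x.2⟩ ≤ a y := fun x => by
    by_cases hx : U.tree.level x = δ.1
    · obtain ⟨y, hy⟩ := hUD ⟨U, x.1, x.2⟩ rfl hx 0
      exact ⟨y, fun _ => hy⟩
    · obtain ⟨-, -, y, -⟩ := H.le_iSup_iff.1 (ha.2 ▸ le_top : i ⟨U, x.1, x.2⟩ ≤ _) _ le_rfl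
      exact ⟨y, fun h => absurd h hx⟩
  choose v hv using hch
  refine ⟨U, hU, Set.range v, Set.countable_range v, fun p hp => H.le_of_dense fun q hq => ?_⟩
  -- Once the node of a condition reaches level `δ`, it has at or below it a sealed node of `U`,
  -- which decides the value of the name.
  obtain ⟨r, hr, hlev⟩ := exists_level_ge hf q δ.2
  have hrU : r.cond ≤ U := hr.1.trans (hq.1.trans hp)
  obtain ⟨z, hz, hzl⟩ := r.cond.tree.exists_le_level_eq hlev
  have hzU : z ∈ U.tree.carrier :=
    (EndExt.mem_iff hrU).2 ⟨hz.mem_left r.mem, by rw [hzl, hδ]; exact lt_add_one _⟩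
  refine ⟨r, hr, le_iSup₂_of_le (v ⟨z, hzU⟩) ⟨_, rfl⟩ (le_trans (H.mono ?_)
    (hv ⟨z, hzU⟩ ((EndExt.level_eq hrU hzU).trans hzl)))⟩
  exact ⟨hrU, hz⟩

end PairCond

end CutChoose

/-! ### Properness -/

namespace CutChoose

open CountableTree TreeForcing

/-- The `n`-th of a list of all finite sequences of entries of `z`; only entries with index at
most `n` are used. -/
def listOfEntries {X : Type*} (z : ℕ → X) (n : ℕ) : List X :=
  ((Encodable.decode (α := List ℕ) n.unpair.1).getD []).map fun j => z (min j n)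

theorem listOfEntries_congr {X : Type*} {z z' : ℕ → X} {n : ℕ} (h : ∀ j ≤ n, z j = z' j) :
    listOfEntries z n = listOfEntries z' n :=
  List.map_congr_left fun _ _ => h _ (min_le_right _ _)

theorem exists_listOfEntries_eq {X : Type*} {z : ℕ → X} {e : List X}
    (he : ∀ x ∈ e, x ∈ Set.range z) : ∃ n, listOfEntries z n = e := by
  have : e ∈ Set.range (List.map z) := by
    rw [Set.range_list_map]
    exact he
  obtain ⟨l, rfl⟩ := this
  have hl : ∀ j ∈ l, j ≤ l.sum := fun j hj => List.le_sum_of_mem hj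
  refine ⟨Nat.pair (Encodable.encode l) l.sum, ?_⟩
  rw [listOfEntries, Nat.unpair_pair, Encodable.encodek, Option.getD_some]
  refine List.map_congr_left fun j hj => ?_
  rw [min_eq_left ((hl j hj).trans (Nat.right_le_pair _ _))]

namespace PairCond

variable {S : Set Omega1} {f : CountableTree → CountableTree}

/-- A sequence `z` in `X` directs a descending sequence of trees, the `n`-th step bounding the value
of `F` at the `n`-th finite sequence of entries by a countable set. Stationarity gives `Z ∈ 𝒮`,
enumerated by some `z`, containing all these bounds; a lower bound of the trees then forces `Z` to
be closed under `F`. -/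
theorem isProper {B : Type} [CompleteBooleanAlgebra B] {i : PairCond S f → B}
    (H : IsDensePresentation i) (hf : IsMandatoryExtension f) (hS : IsStationary Sᶜ) :
    IsProper B := by
  intro X _ 𝒮 hcount hst F hF
  refine top_le_iff.1 (H.le_of_forall fun p _ => ?_)
  have x₀ : X := Classical.arbitrary X
  have hval : ∀ (T : TreeForcing S f) (e : List X), ∃ U ≤ T, ∃ v : ℕ → X,
      ∀ p : PairCond S f, p.cond ≤ U → i p ≤ ⨆ y ∈ Set.range v, F e y := by
    intro T e
    obtain ⟨U, hU, C, hC, h⟩ := exists_countable_values H hf hS (hF e) T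
    obtain ⟨v, hv⟩ := (hC.union (Set.countable_singleton x₀)).exists_eq_range ⟨_, Or.inr rfl⟩
    exact ⟨U, hU, v, fun p hp => (h p hp).trans
      (biSup_mono fun y hy => hv ▸ Or.inl hy)⟩
  choose ext hext v hv using hval
  let tr : (ℕ → X) → ℕ → TreeForcing S f := fun z n =>
    Nat.rec p.cond (fun n T => ext T (listOfEntries z n)) n
  have htr : ∀ z n, tr z (n + 1) = ext (tr z n) (listOfEntries z n) := fun z n => rfl
  have htrc : ∀ z z' n, (∀ j < n, z j = z' j) → tr z n = tr z' n := by
    intro z z' n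
    induction n with
    | zero => exact fun _ => rfl
    | succ n ih =>
      intro h
      rw [htr, htr, ih fun j hj => h j (hj.trans n.lt_succ_self),
        listOfEntries_congr fun j hj => h j (Nat.lt_succ_of_le hj)]
  let w : (ℕ → X) → ℕ → ℕ → X := fun z n k => v (tr z n) (listOfEntries z n) k
  -- A list serves twice: its length minus one codes `(n, k)`, and its entries are an initial
  -- segment of `z`. Length `Nat.pair n k + 1` suffices, since `w z n k` depends only on `z 0, …, z
  -- n` and `n ≤ Nat.pair n k`.
  obtain ⟨Z, hZ, hcl⟩ := hst fun l => w (fun j => l.getD j x₀) (l.length - 1).unpair.1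
    (l.length - 1).unpair.2
  obtain ⟨z, rfl⟩ := (hcount Z hZ).exists_eq_range ⟨_, hcl [] (by simp)⟩
  have hw : ∀ n k, w z n k ∈ Set.range z := by
    intro n k
    have := hcl ((List.range (Nat.pair n k + 1)).map z) (by simp)
    beta_reduce at this
    rw [List.length_map, List.length_range, Nat.add_sub_cancel, Nat.unpair_pair] at this
    convert this using 1
    have hz : ∀ j ≤ n, z j = ((List.range (Nat.pair n k + 1)).map z).getD j x₀ := by
      intro j hj
      have : j < Nat.pair n k + 1 := Nat.lt_succ_of_le (hj.trans (Nat.left_le_pair _ _))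
      simp [List.getD, this]
    simp only [w]
    rw [htrc z _ n fun j hj => hz j hj.le, listOfEntries_congr hz]
  obtain ⟨T, hT⟩ := isSigmaClosed S f (tr z) (antitone_nat_of_succ_le fun n => hext _ _)
  refine ⟨p.lift (hT 0), p.lift_le _, le_iSup₂_of_le (Set.range z) hZ
    (le_iInf fun e => le_iInf fun he => ?_)⟩
  obtain ⟨n, hn⟩ := exists_listOfEntries_eq he
  have := hv (tr z n) (listOfEntries z n) (p.lift (hT 0)) (hT (n + 1))
  rw [hn] at this
  refine this.trans (biSup_mono ?_)
  rintro y ⟨k, rfl⟩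
  rw [← hn]
  exact hw n k

end PairCond

/-! ### Density -/

theorem mk_node_le : #Node ≤ 𝔠 := by
  rw [Cardinal.mk_toType]
  simpa using Cardinal.aleph_one_le_continuum

/-- A tree is recovered from an enumeration of its nodes and the order pulled back to `ℕ`; `none`
allows for the empty tree. -/
theorem mk_countableTree_le : #CountableTree ≤ 𝔠 := by
  have hx : ∀ T : CountableTree, ∃ e : ℕ → Option Node, ∀ x, x ∈ T.carrier ↔ some x ∈ Set.range e := by
    intro T
    obtain ⟨e, he⟩ := ((T.countable.image some).union
      (Set.countable_singleton none)).exists_eq_range ⟨none, Or.inr rfl⟩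
    exact ⟨e, fun x => by rw [← he]; simp⟩
  choose e he using hx
  let code : CountableTree → (ℕ → Option Node) × (ℕ → ℕ → Prop) := fun T =>
    (e T, fun n m => ∃ x y, e T n = some x ∧ e T m = some y ∧ T.lt x y)
  have hinj : Function.Injective code := by
    intro T T' h
    have h1 : e T = e T' := congrArg Prod.fst h
    have h2 := congrArg Prod.snd h
    have hlt : ∀ T T', code T = code T' → ∀ x y, T.lt x y → T'.lt x y := by
      intro T T' h x y hxy
      have h1 : e T = e T' := congrArg Prod.fst h
      obtain ⟨n, hn⟩ := (he T x).1 (T.lt_mem hxy).1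
      obtain ⟨m, hm⟩ := (he T y).1 (T.lt_mem hxy).2
      have h2 : (code T).2 n m := ⟨x, y, hn, hm, hxy⟩
      rw [h] at h2
      obtain ⟨x', y', hx', hy', hlt⟩ := h2
      rw [← h1, hn] at hx'
      rw [← h1, hm] at hy'
      obtain rfl := Option.some.inj hx'
      obtain rfl := Option.some.inj hy'
      exact hlt
    ext x y
    · rw [he, he, h1]
    · exact ⟨hlt T T' h x y, hlt T' T h.symm x y⟩
  have hnode : #(Option Node) ≤ 𝔠 := by
    rw [Cardinal.mk_option]
    exact Cardinal.add_le_of_le Cardinal.aleph0_le_continuum mk_node_le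
      (Cardinal.one_le_aleph0.trans Cardinal.aleph0_le_continuum)
  refine (Cardinal.mk_le_of_injective hinj).trans ?_
  rw [Cardinal.mk_prod, Cardinal.lift_id, Cardinal.lift_id]
  refine (mul_le_mul' ?_ ?_).trans Cardinal.continuum_mul_self.le
  · rw [← Cardinal.power_def, Cardinal.mk_nat]
    exact (Cardinal.power_le_power_right hnode).trans Cardinal.continuum_power_aleph0.le
  · simp

instance TreeForcing.instNonempty (S : Set Omega1) (f : CountableTree → CountableTree) :
    Nonempty (TreeForcing S f) := by
  let T : CountableTree :=
    { carrier := ∅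
      lt := fun _ _ => False
      countable := Set.countable_empty
      lt_mem := False.elim
      trans := fun h => h.elim
      wellOrder := fun _ => isWellOrder_of_rank (lt := fun _ _ => False) (p := fun _ => False)
        (fun _ => 0) (fun _ _ h => h.elim) fun _ _ h => h.elim }
  refine ⟨⟨T, fun x hx => absurd hx (Set.notMem_empty x), fun β _ hβ => ?_⟩⟩
  obtain ⟨x, hx, -⟩ := T.exists_level_eq hβ
  exact absurd hx (Set.notMem_empty x)

namespace PairCond

variable {S : Set Omega1} {f : CountableTree → CountableTree}

variable (S f) in
theorem mk_pairCond_le : #(PairCond S f) ≤ 𝔠 := by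
  have hinj : Function.Injective fun p : PairCond S f => (p.cond.tree, p.node) := by
    rintro ⟨⟨T, _, _⟩, x, _⟩ ⟨⟨T', _, _⟩, x', _⟩ h
    obtain ⟨rfl, rfl⟩ := Prod.mk.inj h
    rfl
  refine (Cardinal.mk_le_of_injective hinj).trans ?_
  rw [Cardinal.mk_prod, Cardinal.lift_id, Cardinal.lift_id]
  refine (mul_le_mul' mk_countableTree_le mk_node_le).trans Cardinal.continuum_mul_self.le

/-- Over one tree whose height is not in `S`, the label of the top node on the `n`-th branch is
chosen among two fresh nodes according to `r n`. Distinct trees of the same height have no common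
end-extension. -/
theorem exists_incompatible (hf : IsMandatoryExtension f) (hS : IsStationary Sᶜ) :
    ∃ p : (ℕ → Bool) → PairCond S f, ∀ r r', r ≠ r' → ∀ q, q ≤ p r → ¬ q ≤ p r' := by
  obtain ⟨U, -, δ, hδ, hUδ, b, hb, hcov, -⟩ := exists_limit (S := S) hf hS (D := fun _ => Set.univ)
    (fun _ => isLowerSet_univ) (Classical.arbitrary (TreeForcing S f)) (fun _ p _ => ⟨p, le_rfl, trivial⟩)
  obtain ⟨g, hg, hgT⟩ := U.tree.exists_fresh
  have hg' : ∀ r : ℕ → Bool, Function.Injective fun n => g (2 * n + (r n).toNat) := by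
    intro r n m h
    have h := hg h
    have h1 := Bool.toNat_lt (r n)
    have h2 := Bool.toNat_lt (r m)
    omega
  choose V hVU hVh hVc hVlt hVl using fun r : ℕ → Bool =>
    exists_addTop U b hb (fun n => g (2 * n + (r n).toNat)) (hg' r) (fun n => hgT _) hcov hδ
  refine ⟨fun r => ⟨V r, g (2 * 0 + (r 0).toNat), (hVc r _).2 (Or.inr ⟨0, rfl⟩)⟩, ?_⟩
  intro r r' hne q h1 h2
  have h12 : (V r).tree = (V r').tree := by
    rw [show (V r).tree = _ from h1.1, show (V r').tree = _ from h2.1, hVh, hVh]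
  obtain ⟨n, hn⟩ := Function.ne_iff.1 hne
  have hmem : g (2 * n + (r n).toNat) ∈ (V r').tree.carrier := by
    rw [← h12]
    exact (hVc r _).2 (Or.inr ⟨n, rfl⟩)
  rcases (hVc r' _).1 hmem with h | ⟨m, hm⟩
  · exact hgT _ h
  · have hm := hg hm
    have h1 := Bool.toNat_lt (r n)
    have h2 := Bool.toNat_lt (r' m)
    have hmn : m = n := by omega
    subst hmn
    apply hn
    have : (r m).toNat = (r' m).toNat := by omega
    revert this
    cases r m <;> cases r' m <;> simp

theorem density_eq {B : Type} [CompleteBooleanAlgebra B] {i : PairCond S f → B}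
    (H : IsDensePresentation i) (hf : IsMandatoryExtension f) (hS : IsStationary Sᶜ) :
    density B = 𝔠 := by
  have hmem : #(Set.range i) ∈ {κ | ∃ D : Set B, IsDenseSubset D ∧ #D = κ} :=
    ⟨Set.range i, ⟨by rintro _ ⟨p, rfl⟩; exact H.ne_bot p, fun b hb => by
      obtain ⟨p, hp⟩ := H.dense b hb
      exact ⟨_, ⟨p, rfl⟩, hp⟩⟩, rfl⟩
  refine le_antisymm ((csInf_le' hmem).trans (Cardinal.mk_range_le.trans (mk_pairCond_le S f)))
    (le_csInf ⟨_, hmem⟩ ?_)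
  rintro _ ⟨D, ⟨hD0, hD⟩, rfl⟩
  obtain ⟨p, hp⟩ := exists_incompatible (S := S) hf hS
  choose d hdD hd using fun r => hD (i (p r)) (H.ne_bot _)
  have hinj : Function.Injective fun r => (⟨d r, hdD r⟩ : D) := by
    intro r r' h
    by_contra hne
    have h : d r = d r' := congrArg Subtype.val h
    obtain ⟨q, hq⟩ := H.dense _ (hD0 _ (hdD r))
    have : i (p r) ⊓ i (p r') ≠ ⊥ := fun h0 => H.ne_bot q (le_bot_iff.1 (h0 ▸
      le_inf (hq.trans (hd r)) (hq.trans (h ▸ hd r'))))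
    obtain ⟨e, he, he'⟩ := H.compat _ _ this
    exact hp r r' hne e he he'
  simpa using Cardinal.mk_le_of_injective hinj

end PairCond

end CutChoose

/-! ### Fusion against a mandatory level: the descending chain game -/

namespace CutChoose

theorem IsDensePresentation.exists_le_of_le {D B : Type*} [Preorder D] [CompleteBooleanAlgebra B]
    {i : D → B} (H : IsDensePresentation i) {d d' : D} (h : i d ≤ i d') : ∃ e ≤ d, e ≤ d' :=
  H.compat d d' (by rw [inf_eq_left.2 h]; exact H.ne_bot d)

theorem IsDensePresentation.exists_le_le {D B : Type*} [Preorder D] [CompleteBooleanAlgebra B]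
    {i : D → B} (H : IsDensePresentation i) {d : D} {b : B} (hb : b ≠ ⊥) (h : b ≤ i d) :
    ∃ e ≤ d, i e ≤ b := by
  obtain ⟨d', hd'⟩ := H.dense b hb
  obtain ⟨e, he, he'⟩ := H.exists_le_of_le (hd'.trans h)
  exact ⟨e, he', (H.mono he).trans hd'⟩

namespace PairCond

open TreeForcing CountableTree

variable {S : Set Omega1} {f : CountableTree → CountableTree}

/-- A condition deep enough is below another one as soon as it is so in the Boolean algebra. -/
theorem le_of_presentation_le {B : Type*} [CompleteBooleanAlgebra B] {i : PairCond S f → B}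
    (H : IsDensePresentation i) {p q : PairCond S f} (h : i q ≤ i p)
    (hlev : p.cond.tree.height ≤ q.cond.tree.level q.node) : q ≤ p := by
  obtain ⟨e, heq, hep⟩ := H.exists_le_of_le h
  have hq : p.cond.tree.height ≤ q.cond.tree.height :=
    hlev.trans (q.cond.tree.level_lt_height q.mem).le
  refine ⟨EndExt.of_common heq.1 hep.1 hq, (EndExt.le_iff heq.1 q.mem).2 ?_⟩
  refine le_of_level_le _ hep.2 heq.2 ?_
  rw [← EndExt.level_eq heq.1 q.mem, ← EndExt.level_eq hep.1 p.mem]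
  exact (p.cond.tree.level_lt_height p.mem).le.trans hlev

/-- One step of the fusion: all positions of a countable family are extended twice, with the nodes
of the two extensions incompatible. -/
theorem exists_split {B : Type*} [CompleteBooleanAlgebra B] {i : PairCond S f → B}
    (H : IsDensePresentation i) (hf : IsMandatoryExtension f) (hS : IsStationary Sᶜ)
    {Pos ι : Type*} [Countable ι] (a : Pos → B) (ext : Pos → Pos → Prop) (ha : ∀ t, a t ≠ ⊥)
    (hext : ∀ t b, b ≤ a t → b ≠ ⊥ → ∃ t', ext t t' ∧ a t' ≤ b)
    (T : TreeForcing S f) (g : ι → Pos × PairCond S f) (hg : ∀ k, (g k).2.cond = T)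
    (hga : ∀ k, i (g k).2 ≤ a (g k).1) {α : Ordinal.{0}} (hα : α < ω_ 1) :
    ∃ U ≤ T, α < U.tree.height ∧ ∃ g' : ι → Bool → Pos × PairCond S f,
      (∀ k v, (g' k v).2.cond = U ∧ i (g' k v).2 ≤ a (g' k v).1 ∧ ext (g k).1 (g' k v).1 ∧
        a (g' k v).1 ≤ i (g k).2) ∧
      ∀ k, ∃ y z, y ≠ z ∧ U.tree.level y = U.tree.level z ∧ U.tree.Le y (g' k true).2.node ∧
        U.tree.Le z (g' k false).2.node := by
  obtain ⟨T₁, hT₁, hα₁⟩ := exists_height_gt hf hα T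
  -- Sealing is used here for its splitting clause only, hence with trivial dense sets.
  obtain ⟨T₂, hT₂, δ, -, -, hsplit⟩ := exists_sealed (S := S) hf hS (D := fun _ => Set.univ)
    (fun _ => isLowerSet_univ) T₁ fun _ p _ => ⟨p, le_rfl, trivial⟩
  have hy : ∀ k, ∃ y : Bool → Node, (∀ v, T₂.tree.lt (g k).2.node (y v)) ∧ y true ≠ y false ∧
      T₂.tree.level (y true) = T₂.tree.level (y false) := by
    intro k
    have hk : (g k).2.node ∈ T₁.tree.carrier := carrier_mono hT₁ (hg k ▸ (g k).2.mem)
    obtain ⟨y, z, h1, h2, h3, h4, h5⟩ := hsplit _ hk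
    refine ⟨fun v => if v then y else z, ?_, by simpa using h3, by simp [h4, h5]⟩
    rintro (_ | _)
    · simpa using h2
    · simpa using h1
  choose y hlt hne hlev using hy
  have hmem : ∀ k v, y k v ∈ T₂.tree.carrier := fun k v => (T₂.tree.lt_mem (hlt k v)).2
  obtain ⟨U, hU, h⟩ := (isSigmaClosed S f).exists_forall (ι := ι × Bool)
    (R := fun k T' => ∃ c : Pos × PairCond S f, c.2.cond = T' ∧ i c.2 ≤ a c.1 ∧
      ext (g k.1).1 c.1 ∧ a c.1 ≤ i (g k.1).2 ∧ T'.tree.Le (y k.1 k.2) c.2.node)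
    (by
      rintro k _ T' hle ⟨c, rfl, h1, h2, h3, h4⟩
      exact ⟨(c.1, c.2.lift hle), rfl, (H.mono (c.2.lift_le hle)).trans h1, h2, h3,
        EndExt.le hle h4⟩) T₂
    (by
      rintro ⟨k, v⟩ T' hT'
      let p : PairCond S f := ⟨T', y k v, carrier_mono hT' (hmem k v)⟩
      have hp : p ≤ (g k).2 := ⟨by rw [hg k]; exact (hT'.trans hT₂).trans hT₁,
        Or.inl (lt_mono hT' (hlt k v))⟩
      obtain ⟨t', ht', hat'⟩ := hext (g k).1 (i p) ((H.mono hp).trans (hga k)) (H.ne_bot p)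
      obtain ⟨e, he, hea⟩ := H.exists_le_le (ha t') hat'
      exact ⟨e.cond, he.1, (t', e), rfl, hea, ht', hat'.trans (H.mono hp), he.2⟩)
  choose g' h1 h2 h3 h4 h5 using h
  refine ⟨U, (hU.trans hT₂).trans hT₁, hα₁.trans_le (height_mono (hU.trans hT₂)),
    fun k v => g' (k, v), fun k v => ⟨h1 (k, v), h2 (k, v), h3 (k, v), h4 (k, v)⟩, fun k =>
      ⟨y k true, y k false, hne k, ?_, h5 (k, true), h5 (k, false)⟩⟩
  rw [← EndExt.level_eq hU (hmem k _), ← EndExt.level_eq hU (hmem k _), hlev]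

/-- The initial segments of an infinite sequence, as lists in reverse order. -/
def revInit (r : ℕ → Bool) (n : ℕ) : List Bool := Nat.rec [] (fun n l => r n :: l) n

theorem revInit_congr {r r' : ℕ → Bool} {n : ℕ} (h : ∀ m < n, r m = r' m) :
    revInit r n = revInit r' n := by
  induction n with
  | zero => rfl
  | succ n ih =>
    exact congrArg₂ List.cons (h n n.lt_succ_self) (ih fun m hm => h m (hm.trans n.lt_succ_self))

/-- If the mandatory levels are stationarily many, then player II has no winning strategy in
descending games. Here `Pos` is the set of positions of a game in which a strategy is followed,
`a t` is the last move of II, and `ext` relates a position to the ones that can follow it. -/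
theorem not_strategy {B : Type*} [CompleteBooleanAlgebra B] {i : PairCond S f → B}
    (H : IsDensePresentation i) (hf : IsMandatoryExtension f) (hS : IsStationary S)
    (hSc : IsStationary Sᶜ) {Pos : Type*} (a : Pos → B) (ext : Pos → Pos → Prop) (ha : ∀ t, a t ≠ ⊥)
    (hext : ∀ t b, b ≤ a t → b ≠ ⊥ → ∃ t', ext t t' ∧ a t' ≤ b) (t₀ : Pos)
    (hlim : ∀ t : ℕ → Pos, t 0 = t₀ → (∀ n, ext (t n) (t (n + 1))) → ⨅ n, a (t n) ≠ ⊥) : False := by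
  obtain ⟨p₀, hp₀⟩ := H.dense _ (ha t₀)
  -- A state is a tree with a position and a pair for every finite binary list, all pairs having
  -- this same tree. The plays thus differ only in their nodes, and one tree `U` of height in `S` is
  -- the limit for all of them.
  obtain ⟨s, hs₀, hI, hR, hanti, δ, hδ, hlt, U, hU, hUδ, hUc, hcof⟩ := exists_targeted (S := S) (f := f)
    (σ := TreeForcing S f × (List Bool → Pos × PairCond S f)) Prod.fst
    (fun _ s => ∀ l, (s.2 l).2.cond = s.1 ∧ i (s.2 l).2 ≤ a (s.2 l).1)
    (fun _ s s' => (∀ l v, ext (s.2 l).1 (s'.2 (v :: l)).1 ∧ a (s'.2 (v :: l)).1 ≤ i (s.2 l).2) ∧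
      ∀ l, ∃ y z, y ≠ z ∧ s'.1.tree.level y = s'.1.tree.level z ∧
        s'.1.tree.Le y (s'.2 (true :: l)).2.node ∧ s'.1.tree.Le z (s'.2 (false :: l)).2.node)
    (by
      rintro - ⟨T, g⟩ hI α hα
      obtain ⟨U, hU, hαU, g', hg', hsplit⟩ := exists_split H hf hSc a ext ha hext T g
        (fun l => (hI l).1) (fun l => (hI l).2) hα
      -- Stage `n` matters only at lists of length `n`; the value at `[]` is a filler that keeps the
      -- invariant true for all lists.
      refine ⟨(U, fun l => match l with
        | [] => g' [] true
        | v :: l => g' l v), ?_, ⟨fun l v => (hg' l v).2.2, fun l => hsplit l⟩, hU, hαU⟩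
      rintro (_ | ⟨v, l⟩)
      · exact ⟨(hg' [] true).1, (hg' [] true).2.1⟩
      · exact ⟨(hg' l v).1, (hg' l v).2.1⟩)
    hS (p₀.cond, fun _ => (t₀, p₀)) fun _ => ⟨rfl, hp₀⟩
  have hfU : EndExt (f U.tree) U.tree := (hf _ U.extendible).2.2
  -- A condition below the meet of the play along `r`, with its node at level `δ` or higher, has a
  -- tree end-extending `U`. As `δ ∈ S`, level `δ` of that tree is the one in `f U`, so the part of
  -- its node on that level belongs to a tree not depending on `r`.
  have key : ∀ r : ℕ → Bool, ∃ y ∈ (f U.tree).carrier,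
      ∀ n, (f U.tree).Le ((s n).2 (revInit r n)).2.node y := by
    intro r
    have hne := hlim (fun n => ((s n).2 (revInit r n)).1) (by rw [hs₀])
      fun n => ((hR n).1 (revInit r n) (r n)).1
    obtain ⟨d, hd⟩ := H.dense _ hne
    obtain ⟨q, hqd, hq⟩ := exists_level_ge hf d δ.2
    have hqn : ∀ n, q ≤ ((s n).2 (revInit r n)).2 := fun n =>
      le_of_presentation_le H ((H.mono hqd).trans (hd.trans ((iInf_le _ (n + 1)).trans
        ((hR n).1 (revInit r n) (r n)).2))) (by rw [(hI n _).1]; exact (hlt n).le.trans hq)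
    have hqs : ∀ n, q.cond ≤ (s n).1 := fun n => (hI n (revInit r n)).1 ▸ (hqn n).1
    have hqU : EndExt q.cond.tree U.tree := by
      refine EndExt.of_forall (fun x hx => ?_) (fun x y hy => ?_) fun x hx hlev => ?_
      · obtain ⟨n, hn⟩ := hUc x hx
        exact carrier_mono (hqs n) hn
      · obtain ⟨n, hn⟩ := hUc y hy
        exact (EndExt.lt_iff (hU n) hn).symm.trans (EndExt.lt_iff (hqs n) hn)
      · obtain ⟨n, hn⟩ := hcof _ (hUδ ▸ hlev)
        exact carrier_mono (hU n) ((EndExt.mem_iff (hqs n)).2 ⟨hx, hn⟩)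
    have hqf : q.cond.tree.restrict (δ.1 + 1) = f U.tree := by
      rw [q.cond.mandatory δ hδ (hq.trans_lt (q.cond.tree.level_lt_height q.mem)), ← hUδ, ← hqU]
    obtain ⟨y, hy, hylev⟩ := q.cond.tree.exists_le_level_eq hq
    have hyf : y ∈ (f U.tree).carrier := by
      rw [← hqf]
      exact ⟨hy.mem_left q.mem, by rw [hylev]; exact lt_add_one _⟩
    refine ⟨y, hyf, fun n => ?_⟩
    have hqf' : EndExt q.cond.tree (f U.tree) := by
      rw [EndExt, (hf _ U.extendible).2.1, hUδ, hqf]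
    refine (EndExt.le_iff hqf' hyf).2 (le_of_level_le _ (hqn n).2 hy ?_)
    have hmem : ((s n).2 (revInit r n)).2.node ∈ (s n).1.tree.carrier :=
      (hI n (revInit r n)).1 ▸ ((s n).2 (revInit r n)).2.mem
    rw [hylev, ← EndExt.level_eq (hqs n) hmem]
    exact ((s n).1.tree.level_lt_height hmem).le.trans (hlt n).le
  choose y hy hle using key
  have hsep : ∀ (l : List Bool) n x, (f U.tree).Le ((s (n + 1)).2 (true :: l)).2.node x →
      ¬ (f U.tree).Le ((s (n + 1)).2 (false :: l)).2.node x := by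
    intro l n x h1 h2
    obtain ⟨y, z, hne, hlev, hy, hz⟩ := (hR n).2 l
    have hext := hfU.trans (hU (n + 1))
    have hm : ∀ l, ((s (n + 1)).2 l).2.node ∈ (s (n + 1)).1.tree.carrier := fun l =>
      (hI (n + 1) l).1 ▸ ((s (n + 1)).2 l).2.mem
    have hlev' : (f U.tree).level y = (f U.tree).level z := by
      rw [← hext.level_eq (hy.mem_left (hm _)), ← hext.level_eq (hz.mem_left (hm _)), hlev]
    rcases le_of_level_le _ ((hext.le hy).trans h1) ((hext.le hz).trans h2) hlev'.le with h | h
    · exact ((f U.tree).level_lt_level h).ne hlev'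
    · exact hne h
  -- At the first difference of `r` and `r'` the nodes were split, so nothing lies above both plays.
  have hinj : Function.Injective fun r => (⟨y r, hy r⟩ : (f U.tree).carrier) := by
    intro r r' h
    have h : y r = y r' := congrArg Subtype.val h
    by_contra hne
    have hex : ∃ n, r n ≠ r' n := by
      by_contra! hc
      exact hne (funext hc)
    have hn := Nat.find_spec hex
    have hmin : ∀ m < Nat.find hex, r m = r' m := fun m hm => not_not.1 (Nat.find_min hex hm)
    set n := Nat.find hex
    have h1 := hle r (n + 1)
    have h2 := hle r' (n + 1)
    rw [← h] at h2
    change (f U.tree).Le ((s (n + 1)).2 (r n :: revInit r n)).2.node _ at h1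
    change (f U.tree).Le ((s (n + 1)).2 (r' n :: revInit r' n)).2.node _ at h2
    rw [← revInit_congr hmin] at h2
    cases hr : r n <;> cases hr' : r' n <;> rw [hr] at h1 hn <;> rw [hr'] at h2 hn
    · exact hn rfl
    · exact hsep _ _ _ h2 h1
    · exact hsep _ _ _ h1 h2
    · exact hn rfl
  have := (f U.tree).countable.to_subtype
  have := hinj.countable
  exact (Cardinal.aleph0_lt_continuum).not_ge (by
    rw [← Cardinal.mk_le_aleph0_iff, ← Cardinal.power_def] at this
    simpa using this)

theorem _root_.CutChoose.initialMoves_congr {B : Type*} {b b' : ℕ → B} {n : ℕ} (h : ∀ m < n, b m = b' m) :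
    initialMoves b n = initialMoves b' n :=
  List.map_congr_left fun m hm => h m (List.mem_range.1 hm)

theorem _root_.CutChoose.LegalAgainst.congr {B : Type*} [CompleteBooleanAlgebra B] {τ : List B → B} {b b' : ℕ → B}
    {n : ℕ} (h : ∀ m ≤ n, b m = b' m) (hb : LegalAgainst τ b n) : LegalAgainst τ b' n := by
  refine ⟨fun k hk => h k hk ▸ hb.1 k hk, fun k hk => ?_⟩
  rw [← h (k + 1) hk, ← initialMoves_congr fun m hm => h m (by omega)]
  exact hb.2 k hk

theorem _root_.CutChoose.IsDensePresentation.top_ne_bot {B : Type*} [CompleteBooleanAlgebra B]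
    {i : PairCond S f → B} (H : IsDensePresentation i) (hf : IsMandatoryExtension f) :
    (⊤ : B) ≠ ⊥ := by
  intro h
  obtain ⟨T, -, hT⟩ := exists_height_gt hf (omega_pos 1) (Classical.arbitrary (TreeForcing S f))
  obtain ⟨x, hx, -⟩ := T.tree.exists_level_eq hT
  exact H.ne_bot ⟨T, x, hx⟩ (le_bot_iff.1 (h ▸ le_top))

/-- Player II has no winning strategy in the descending chain game. -/
theorem not_iiWinsDescending {B : Type*} [CompleteBooleanAlgebra B] {i : PairCond S f → B}
    (H : IsDensePresentation i) (hf : IsMandatoryExtension f) (hS : IsStationary S)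
    (hSc : IsStationary Sᶜ) : ¬ IIWinsDescending B := by
  rintro ⟨τ, hτ, hwin⟩
  have htop := H.top_ne_bot hf
  -- The number is the index of the last move of I; later entries of the sequence are immaterial.
  let Pos := {p : (ℕ → B) × ℕ // LegalAgainst τ p.1 p.2}
  refine not_strategy H hf hS hSc (Pos := Pos) (fun t => τ (initialMoves t.1.1 (t.1.2 + 1)))
    (fun t t' => t'.1.2 = t.1.2 + 1 ∧ ∀ m ≤ t.1.2, t'.1.1 m = t.1.1 m)
    (fun t => (hτ _ _ t.2).1) ?_ ⟨(fun _ => ⊤, 0), fun _ _ => htop, by simp⟩ ?_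
  · rintro ⟨⟨c, n⟩, hc⟩ b hb hb0
    have hagree : ∀ m ≤ n, Function.update c (n + 1) b m = c m := fun m hm =>
      Function.update_of_ne (by omega) _ _
    have hleg : LegalAgainst τ (Function.update c (n + 1) b) (n + 1) := by
      have h := hc.congr fun m hm => (hagree m hm).symm
      refine ⟨fun k hk => ?_, fun k hk => ?_⟩
      · rcases Nat.le_succ_iff.1 hk with hk | rfl
        · exact h.1 k hk
        · rwa [Function.update_self]
      · rcases Nat.lt_succ_iff_lt_or_eq.1 hk with hk | rfl
        · exact h.2 k hk
        · rw [Function.update_self, initialMoves_congr fun m hm => hagree m (by omega)]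
          exact hb
    refine ⟨⟨(_, n + 1), hleg⟩, ⟨rfl, hagree⟩, (hτ _ _ hleg).2.trans ?_⟩
    rw [Function.update_self]
  · intro t ht0 ht
    have hn : ∀ n, (t n).1.2 = n := by
      intro n
      induction n with
      | zero => rw [ht0]
      | succ n ih => rw [(ht n).1, ih]
    let b : ℕ → B := fun n => (t n).1.1 n
    have hb : ∀ n, ∀ m ≤ n, (t n).1.1 m = b m := by
      intro n
      induction n with
      | zero => intro m hm; rw [Nat.le_zero.1 hm]
      | succ n ih =>
        intro m hm
        rcases Nat.le_succ_iff.1 hm with hm | rfl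
        · rw [(ht n).2 m (by rw [hn]; exact hm), ih m hm]
        · rfl
    have hleg : ∀ n, LegalAgainst τ b n := fun n => by
      have := (t n).2
      rw [hn] at this
      exact this.congr (hb n)
    refine fun h => hwin b hleg (le_bot_iff.1 (h ▸ le_iInf fun n => ?_))
    rw [hn, initialMoves_congr fun m hm => hb n m (by omega)]
    exact (iInf_le _ (n + 1)).trans ((hleg (n + 1)).2 n n.lt_succ_self)

end PairCond

end CutChoose

namespace CutChoose

/-! ### From cut-and-choose games to descending games -/

/-- A family of sets, each at least as large as the index set, has an injective choice function. -/
theorem exists_injective_choice.{u, v} {ι : Type u} {X : Type v} (A : ι → Set X)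
    (hA : ∀ k, Cardinal.lift.{v} #ι ≤ Cardinal.lift.{u} #(A k)) :
    ∃ c : ι → X, Function.Injective c ∧ ∀ k, c k ∈ A k := by
  -- In a well-order of least possible type, each index has fewer than `#ι` predecessors whose
  -- choices must be avoided.
  obtain ⟨r, hr, hrt⟩ := Cardinal.exists_ord_eq ι
  have hsmall : ∀ (k : ι) (c : {l // r l k} → X), ∃ x ∈ A k, x ∉ Set.range c := by
    intro k c
    by_contra! h
    have h1 : Cardinal.lift.{u} #(A k) ≤ Cardinal.lift.{u} #(Set.range c) :=
      Cardinal.lift_le.2 (Cardinal.mk_le_mk_of_subset h)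
    have h2 : #{l // r l k} < #ι := by
      have := Ordinal.typein_lt_type r k
      rw [← hrt, Cardinal.lt_ord] at this
      exact this
    have h3 := Cardinal.mk_range_le_lift (f := c)
    exact (((hA k).trans h1).trans h3).not_gt (Cardinal.lift_lt.2 h2)
  choose F hF hF' using hsmall
  let c : ι → X := hr.wf.fix fun k ih => F k fun l => ih l.1 l.2
  have hc : ∀ k, c k = F k fun l => c l.1 := fun k => hr.wf.fix_eq _ k
  have hne : ∀ k l, r l k → c k ≠ c l := fun k l hlk h =>
    hF' k (fun l => c l.1) ⟨⟨l, hlk⟩, by rw [← hc]; exact h.symm⟩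
  refine ⟨c, fun k l h => ?_, fun k => by rw [hc]; exact hF _ _⟩
  rcases trichotomous_of r k l with hkl | hkl | hkl
  · exact absurd h.symm (hne l k hkl)
  · exact hkl
  · exact absurd h (hne k l hkl)

/-- The continuous function on the Cantor space given by a function on finite sequences. -/
def treeMap (h : List Bool → Bool) (z : ℕ → Bool) (n : ℕ) : Bool :=
  h (PairCond.revInit z (n + 1))

/-- A Bernstein set: it splits the range of every injective `treeMap`. -/
theorem exists_bernstein : ∃ Y : Set (ℕ → Bool), ∀ h, Function.Injective (treeMap h) →
    (∃ z, treeMap h z ∈ Y) ∧ ∃ z, treeMap h z ∉ Y := by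
  have hcont : #(ℕ → Bool) = 𝔠 := by simp
  -- Every range has size `𝔠` and there are at most `𝔠` functions `h`, so two points can be reserved
  -- in each range, all distinct; `true` marks the points put into `Y`, `false` those kept out.
  obtain ⟨c, hc, hcA⟩ := exists_injective_choice
    (ι := {h : List Bool → Bool // Function.Injective (treeMap h)} × Bool)
    (fun k => Set.range (treeMap k.1.1)) (by
      rintro ⟨⟨h, hh⟩, v⟩
      rw [Cardinal.mk_range_eq _ hh, hcont, Cardinal.lift_id, Cardinal.lift_id, Cardinal.mk_prod,
        Cardinal.lift_id, Cardinal.lift_id]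
      refine (mul_le_mul' (Cardinal.mk_subtype_le _) le_rfl).trans ?_
      rw [← Cardinal.power_def]
      simp)
  refine ⟨Set.range fun h => c (h, true), fun h hh => ⟨?_, ?_⟩⟩
  · obtain ⟨z, hz⟩ := hcA (⟨h, hh⟩, true)
    exact ⟨z, ⟨_, hz.symm⟩⟩
  · obtain ⟨z, hz⟩ := hcA (⟨h, hh⟩, false)
    refine ⟨z, ?_⟩
    rintro ⟨k, hk⟩
    simpa using congrArg Prod.snd (hc (hk.trans hz))

section Positions

variable {B Pos : Type*} [CompleteBooleanAlgebra B]

/-- The piece of the cut `{v, vᶜ}` chosen by a bit. -/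
def side (v : B) (s : Bool) : B := if s then v else vᶜ

theorem side_injective {v w : B} (hw : w ≠ ⊥) {s s' : Bool} (h : w ≤ side v s)
    (h' : w ≤ side v s') : s = s' := by
  have hv : ¬ (w ≤ v ∧ w ≤ vᶜ) := fun h =>
    hw (le_bot_iff.1 (inf_compl_eq_bot (a := v) ▸ le_inf h.1 h.2))
  cases s <;> cases s'
  · rfl
  · exact absurd ⟨h', h⟩ hv
  · exact absurd ⟨h, h'⟩ hv
  · rfl

/-- The positions of a game in which I presents cuts, II follows a winning strategy, and `a t` is
the meet of the pieces chosen up to the position `t`. -/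
structure DecidingPositions (a : Pos → B) (ext : Pos → Pos → Prop) : Prop where
  trans : ∀ {t t' t''}, ext t t' → ext t' t'' → ext t t''
  le : ∀ {t t'}, ext t t' → a t' ≤ a t
  decides : ∀ t v, ∃ t', ext t t' ∧ ∃ s, a t' ≤ side v s
  chain : ∀ t : ℕ → Pos, (∀ n, ext (t n) (t (n + 1))) → ⨅ n, a (t n) ≠ ⊥

/-- The element saying that the index in a partition is a sequence with `n`-th term `true`. -/
def bitValue (d : (ℕ → Bool) → B) (n : ℕ) : B := ⨆ r, ⨆ _ : r n = true, d r

/-- Some bit separates `r` from any other `r'`, so `w` is disjoint from every other piece of the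
partition. -/
theorem le_of_forall_side {d : (ℕ → Bool) → B} (hd : ∀ r r', r ≠ r' → d r ⊓ d r' = ⊥)
    (htop : ⨆ r, d r = ⊤) {w : B} {r : ℕ → Bool} (h : ∀ n, w ≤ side (bitValue d n) (r n)) :
    w ≤ d r := by
  have h0 : ∀ r', r' ≠ r → w ⊓ d r' ≤ d r := by
    intro r' hr'
    obtain ⟨n, hn⟩ : ∃ n, r' n ≠ r n := by
      by_contra! hc
      exact hr' (funext hc)
    have hside : d r' ≤ side (bitValue d n) (r' n) := by
      rcases hb : r' n with _ | _
      · refine le_compl_iff_disjoint_right.2 (disjoint_iff.2 ?_)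
        simp only [bitValue, inf_iSup_eq, iSup_eq_bot]
        intro r'' hr''
        exact hd _ _ fun hc => by rw [hc, hr''] at hb; cases hb
      · exact le_iSup₂ (f := fun r (_ : r n = true) => d r) r' hb
    by_contra hc
    refine hn (side_injective (w := w ⊓ d r') (fun hw => hc (hw ▸ bot_le))
      (inf_le_right.trans hside) (inf_le_left.trans (h n)))
  calc w = w ⊓ ⨆ r', d r' := by rw [htop, inf_top_eq]
    _ = ⨆ r', w ⊓ d r' := inf_iSup_eq _ _
    _ ≤ d r := iSup_le fun r' => by
      by_cases hr : r' = r
      · exact hr ▸ inf_le_right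
      · exact h0 r' hr

namespace DecidingPositions

variable {a : Pos → B} {ext : Pos → Pos → Prop} (P : DecidingPositions a ext)
include P

theorem exists_chain (t : Pos) (v : ℕ → B) : ∃ u : ℕ → Pos, u 0 = t ∧
    (∀ n, ext (u n) (u (n + 1))) ∧ ∀ n, ∃ s, a (u (n + 1)) ≤ side (v n) s := by
  choose F hF hF' using P.decides
  exact ⟨fun n => Nat.rec t (fun n t => F t (v n)) n, rfl, fun n => hF _ _, fun n => hF' _ _⟩

theorem ext_of_chain {u : ℕ → Pos} (hu : ∀ n, ext (u n) (u (n + 1))) (n : ℕ) :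
    ext (u 0) (u (n + 1)) := by
  induction n with
  | zero => exact hu 0
  | succ n ih => exact P.trans ih (hu _)

/-- If each bit could be decided in one way only, the index would be known beforehand. Asking first
for the piece with that index and then for all bits, I would force the answer "yes" to the first
question, and a position below that piece. -/
theorem exists_split {d : (ℕ → Bool) → B} (hd : ∀ r r', r ≠ r' → d r ⊓ d r' = ⊥)
    (htop : ⨆ r, d r = ⊤) {t : Pos} (ht : ∀ t', ext t t' → ∀ r, ¬ a t' ≤ d r) :
    ∃ m, ∀ s, ∃ t', ext t t' ∧ a t' ≤ side (bitValue d m) s := by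
  classical
  by_contra! hc
  choose s hs using hc
  obtain ⟨t', ht', v, hv⟩ := P.decides t (d fun n => !(s n))
  obtain ⟨u, hu0, hu, hus⟩ := P.exists_chain t' (bitValue d)
  choose q hq using hus
  have hqs : ∀ n, q n = !(s n) := by
    intro n
    have hext : ext t (u (n + 1)) := P.trans ht' (hu0 ▸ P.ext_of_chain hu n)
    have : q n ≠ s n := fun h => hs n _ hext (h ▸ hq n)
    revert this
    cases q n <;> cases s n <;> simp
  have hle : ⨅ n, a (u n) ≤ d fun n => !(s n) :=
    le_of_forall_side hd htop fun n => (iInf_le _ (n + 1)).trans (hqs n ▸ hq n)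
  have hv' : v = true :=
    side_injective (P.chain u hu) ((iInf_le _ 0).trans (hu0 ▸ hv)) (s' := true) hle
  exact ht t' ht' _ (by rw [hv'] at hv; exact hv)

/-- Otherwise I first asks whether the index lies in a Bernstein set `Y`, and then plays along each
`z`, splitting bits according to `z`. The resulting index is an injective `treeMap` of `z`, so it is
in `Y` for some `z` and outside for others, although the answer about `Y` was given before `z` came
in. -/
theorem exists_le_partition {d : (ℕ → Bool) → B} (hd : ∀ r r', r ≠ r' → d r ⊓ d r' = ⊥)
    (htop : ⨆ r, d r = ⊤) (t : Pos) : ∃ t', ext t t' ∧ ∃ r, a t' ≤ d r := by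
  by_contra! ht
  obtain ⟨Y, hY⟩ := exists_bernstein
  obtain ⟨t₁, ht₁, β, hβ⟩ := P.decides t (⨆ r ∈ Y, d r)
  -- Each step does two things: it realizes the bit `s` of `z` at a splitting bit `m`, which gives
  -- injectivity, and it decides the bit `n`, so that in the limit all bits are decided.
  have hstep : ∀ (u : {t' // ext t t'}) (n : ℕ), ∃ m, ∀ s : Bool, ∃ u' : {t' // ext t t'},
      ∃ k : Bool, ext u.1 u'.1 ∧ a u'.1 ≤ side (bitValue d m) s ∧ a u'.1 ≤ side (bitValue d n) k := by
    rintro ⟨u, hu⟩ n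
    obtain ⟨m, hm⟩ := P.exists_split hd htop (t := u) fun t' h => ht t' (P.trans hu h)
    refine ⟨m, fun s => ?_⟩
    obtain ⟨u', hu', hm'⟩ := hm s
    obtain ⟨u'', hu'', k, hk⟩ := P.decides u' (bitValue d n)
    exact ⟨⟨u'', P.trans hu (P.trans hu' hu'')⟩, k, P.trans hu' hu'', (P.le hu'').trans hm', hk⟩
  choose m nx k h1 h2 h3 using hstep
  let pos : List Bool → {t' // ext t t'} :=
    fun l => List.rec ⟨t₁, ht₁⟩ (fun s l u => nx u l.length s) l
  let h : List Bool → Bool := fun l => match l with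
    | [] => true
    | s :: l => k (pos l) l.length s
  have hlen : ∀ z n, (PairCond.revInit z n).length = n := by
    intro z n
    induction n with
    | zero => rfl
    | succ n ih => exact congrArg (· + 1) ih
  have hchain : ∀ z n, ext (pos (PairCond.revInit z n)).1 (pos (PairCond.revInit z (n + 1))).1 :=
    fun z n => h1 _ _ _
  have hw := fun z => P.chain _ (hchain z)
  have hbit : ∀ z n, ⨅ n, a (pos (PairCond.revInit z n)).1 ≤ side (bitValue d n) (treeMap h z n) :=
    fun z n => (iInf_le _ (n + 1)).trans (by
      have h := h3 (pos (PairCond.revInit z n)) (PairCond.revInit z n).length (z n)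
      rw [show bitValue d (PairCond.revInit z n).length = bitValue d n by rw [hlen]] at h
      exact h)
  have hinj : Function.Injective (treeMap h) := by
    intro z z' hzz
    by_contra hne
    have hex : ∃ n, z n ≠ z' n := by
      by_contra! hc
      exact hne (funext hc)
    have hn := Nat.find_spec hex
    have hmin : ∀ j < Nat.find hex, z j = z' j := fun j hj => not_not.1 (Nat.find_min hex hj)
    set n := Nat.find hex
    have hs : ∀ z, treeMap h z (m (pos (PairCond.revInit z n)) (PairCond.revInit z n).length) = z n :=
      fun z => side_injective (hw z) (hbit z _) ((iInf_le _ (n + 1)).trans (h2 _ _ _))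
    refine hn ?_
    rw [← hs z, ← hs z', hzz, PairCond.revInit_congr hmin]
  have hside : ∀ z, ⨅ n, a (pos (PairCond.revInit z n)).1 ≤ side (⨆ r ∈ Y, d r) β := fun z =>
    (iInf_le _ 0).trans hβ
  have hdr : ∀ z, ⨅ n, a (pos (PairCond.revInit z n)).1 ≤ d (treeMap h z) := fun z =>
    le_of_forall_side hd htop (hbit z)
  obtain ⟨⟨z, hz⟩, z', hz'⟩ := hY h hinj
  have e1 : β = true := side_injective (hw z) (hside z) (s' := true)
    ((hdr z).trans (le_iSup₂ (f := fun r (_ : r ∈ Y) => d r) _ hz))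
  have e2 : β = false := side_injective (hw z') (hside z') (s' := false) <| (hdr z').trans <| by
    refine le_compl_iff_disjoint_right.2 (disjoint_iff.2 ?_)
    simp only [inf_iSup_eq, iSup_eq_bot]
    intro r hr
    exact hd _ _ fun hc => hz' (hc ▸ hr)
  rw [e1] at e2
  cases e2

/-- A cover is made disjoint along a well-order, each piece losing what earlier pieces contain. -/
theorem exists_le_cover {e : (ℕ → Bool) → B} (htop : ⨆ r, e r = ⊤) (t : Pos) :
    ∃ t', ext t t' ∧ ∃ r, a t' ≤ e r := by
  let R := WellOrderingRel (α := ℕ → Bool)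
  let d : (ℕ → Bool) → B := fun r => e r \ ⨆ r', ⨆ _ : R r' r, e r'
  have hlt : ∀ r r', R r r' → d r ⊓ d r' = ⊥ := fun r r' h => disjoint_iff.1 <|
    (disjoint_sdiff_self_right (x := ⨆ q, ⨆ _ : R q r', e q)).mono_left
      (sdiff_le.trans (le_iSup₂ (f := fun q (_ : R q r') => e q) r h))
  have hd : ∀ r r', r ≠ r' → d r ⊓ d r' = ⊥ := by
    intro r r' hne
    rcases trichotomous_of R r r' with h | h | h
    · exact hlt _ _ h
    · exact absurd h hne
    · rw [inf_comm]
      exact hlt _ _ h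
  have hle : ∀ r, e r ≤ ⨆ r', d r' := by
    intro r
    induction r using (WellOrderingRel.isWellOrder (α := ℕ → Bool)).wf.induction with
    | _ r ih =>
    calc e r ≤ d r ⊔ ⨆ r', ⨆ _ : R r' r, e r' := by rw [sdiff_sup_self]; exact le_sup_left
      _ ≤ ⨆ r', d r' := sup_le (le_iSup d r) (iSup₂_le ih)
  obtain ⟨t', ht', r, hr⟩ := P.exists_le_partition hd (top_le_iff.1 (htop ▸ iSup_le hle)) t
  exact ⟨t', ht', r, hr.trans sdiff_le⟩

/-- Below every position, the possible later choices of II are dense below some element. -/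
theorem exists_dense_below {D : Type*} [Preorder D] {i : D → B} (H : IsDensePresentation i)
    (hcard : #D ≤ 𝔠) (t : Pos) :
    ∃ c ≤ a t, c ≠ ⊥ ∧ ∀ b ≤ c, b ≠ ⊥ → ∃ t', ext t t' ∧ a t' ≤ b := by
  by_contra! hc
  -- If the claim fails, the conditions below which no later position gets are dense below `a t`.
  -- Together with `(a t)ᶜ` they cover `⊤` by at most `𝔠` pieces, yet some later position must get
  -- below a piece.
  let E := Option {d : D // ∀ t', ext t t' → ¬ a t' ≤ i d}
  have hE : #E ≤ 𝔠 := by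
    rw [Cardinal.mk_option]
    exact Cardinal.add_le_of_le Cardinal.aleph0_le_continuum
      ((Cardinal.mk_subtype_le _).trans hcard)
      (Cardinal.one_le_aleph0.trans Cardinal.aleph0_le_continuum)
  have hE' : Cardinal.lift.{0} #E ≤ Cardinal.lift #(ℕ → Bool) := by simpa using hE
  obtain ⟨g⟩ := Cardinal.lift_mk_le'.1 hE'
  let e : E → B := fun k => k.elim (a t)ᶜ fun d => i d.1
  have hsurj := Function.invFun_surjective g.injective
  have htop : ⨆ r, e (Function.invFun g r) = ⊤ := by
    rw [hsurj.iSup_comp]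
    refine top_le_iff.1 ?_
    rw [← sup_compl_eq_top (x := a t)]
    refine sup_le (H.le_of_forall fun d hd => ?_) (le_iSup e none)
    obtain ⟨b, hb, hb0, hbt⟩ := hc (i d) hd (H.ne_bot d)
    obtain ⟨d', hd', hdb⟩ := H.exists_le_le hb0 hb
    exact ⟨d', hd', le_iSup e (some ⟨d', fun t' ht' h => hbt t' ht' (h.trans hdb)⟩)⟩
  obtain ⟨t', ht', r, hr⟩ := P.exists_le_cover htop t
  rcases hk : Function.invFun g r with _ | ⟨d, hd⟩
  · rw [hk] at hr
    have : a t' ≠ ⊥ := by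
      obtain ⟨u, hu0, hu, -⟩ := P.exists_chain t' fun _ => ⊤
      exact fun h => P.chain u hu (le_bot_iff.1 ((iInf_le _ 0).trans (hu0 ▸ h.le)))
    exact this (le_bot_iff.1 (inf_compl_eq_bot (a := a t) ▸ le_inf (P.le ht') hr))
  · rw [hk] at hr
    exact hd t' ht' hr

end DecidingPositions

end Positions

/-- The positions in the cut-and-choose game, II following a winning strategy. -/
theorem decidingPositions {B : Type*} [CompleteBooleanAlgebra B] (σ : B → List B → Bool) (p : B)
    (hσ : ∀ b : ℕ → B, (p ⊓ ⨅ i, ⨅ _ : σ p (initialMoves b (i + 1)) = true, b i) \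
      (⨆ i, ⨆ _ : σ p (initialMoves b (i + 1)) = false, b i) ≠ ⊥) :
    DecidingPositions
      (fun t : (ℕ → B) × ℕ => ⨅ i, ⨅ _ : i < t.2, side (t.1 i) (σ p (initialMoves t.1 (i + 1))))
      (fun t t' => t.2 < t'.2 ∧ ∀ j < t.2, t'.1 j = t.1 j) where
  trans h h' := ⟨h.1.trans h'.1, fun j hj => (h'.2 j (hj.trans h.1)).trans (h.2 j hj)⟩
  le {t t'} h := le_iInf₂ fun j hj => by
    rw [← h.2 j hj, ← initialMoves_congr fun m hm => h.2 m (by omega)]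
    exact iInf₂_le (f := fun i (_ : i < t'.2) => side (t'.1 i) (σ p (initialMoves t'.1 (i + 1)))) j
      (hj.trans h.1)
  decides t v := by
    refine ⟨(Function.update t.1 t.2 v, t.2 + 1), ⟨Nat.lt_succ_self _, fun j hj =>
      Function.update_of_ne hj.ne _ _⟩,
      σ p (initialMoves (Function.update t.1 t.2 v) (t.2 + 1)), ?_⟩
    refine (iInf₂_le t.2 (Nat.lt_succ_self _)).trans ?_
    simp only [Function.update_self, le_refl]
  chain t ht := by
    have hn : ∀ n, n ≤ (t n).2 := by
      intro n
      induction n with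
      | zero => exact Nat.zero_le _
      | succ n ih => exact ih.trans_lt (ht n).1
    have hmn : ∀ n m, n ≤ m → (t n).2 ≤ (t m).2 ∧ ∀ j < (t n).2, (t m).1 j = (t n).1 j := by
      intro n m h
      induction m, h using Nat.le_induction with
      | base => exact ⟨le_rfl, fun _ _ => rfl⟩
      | succ m _ ih =>
        exact ⟨ih.1.trans (ht m).1.le, fun j hj =>
          ((ht m).2 j (hj.trans_le ih.1)).trans (ih.2 j hj)⟩
    -- After `j + 1` extensions more than `j` moves have been made, so the entry `j` is final.
    let b : ℕ → B := fun j => (t (j + 1)).1 j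
    have hb : ∀ n, ∀ j < (t n).2, (t n).1 j = b j := by
      intro n j hj
      rcases le_total n (j + 1) with h | h
      · exact ((hmn _ _ h).2 j hj).symm
      · exact (hmn _ _ h).2 j (hn (j + 1))
    refine fun h => hσ b (le_bot_iff.1 (h ▸ le_iInf fun n => le_iInf₂ fun j hj => ?_))
    rw [hb n j hj, initialMoves_congr fun m hm => hb n m (by omega)]
    rcases hs : σ p (initialMoves b (j + 1)) with _ | _
    · exact (sdiff_le_sdiff le_top (le_iSup₂ (f := fun i
        (_ : σ p (initialMoves b (i + 1)) = false) => b i) j hs)).trans (top_sdiff).le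
    · exact (sdiff_le.trans inf_le_right).trans (iInf₂_le (f := fun i
        (_ : σ p (initialMoves b (i + 1)) = true) => b i) j hs)

/-- Player II has no winning strategy in the cut-and-choose game. -/
theorem PairCond.not_iiWinsCutChoose {S : Set Omega1} {f : CountableTree → CountableTree}
    {B : Type*} [CompleteBooleanAlgebra B] {i : PairCond S f → B}
    (H : IsDensePresentation i) (hf : IsMandatoryExtension f) (hS : IsStationary S)
    (hSc : IsStationary Sᶜ) : ¬ IIWinsCutChoose B := by
  rintro ⟨σ, hσ⟩
  have P := decidingPositions σ ⊤ (hσ ⊤ (H.top_ne_bot hf))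
  have hdense := P.exists_dense_below H (mk_pairCond_le S f)
  set a := fun t : (ℕ → B) × ℕ => ⨅ i, ⨅ _ : i < t.2, side (t.1 i) (σ ⊤ (initialMoves t.1 (i + 1)))
  set ext := fun t t' : (ℕ → B) × ℕ => t.2 < t'.2 ∧ ∀ j < t.2, t'.1 j = t.1 j
  -- A position is paired with an element below which the later meets are dense. That element acts
  -- as the last move of II in a descending game: any nonzero `b` below it can be answered by
  -- playing on until the meet is below `b`.
  let Pos := {t : ((ℕ → B) × ℕ) × B // t.2 ≠ ⊥ ∧
    ∀ b ≤ t.2, b ≠ ⊥ → ∃ t', ext t.1 t' ∧ a t' ≤ b}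
  obtain ⟨c₀, -, hc₀⟩ := hdense (fun _ => ⊤, 0)
  refine not_strategy H hf hS hSc (Pos := Pos) (fun t => t.1.2)
    (fun t t' => ext t.1.1 t'.1.1 ∧ a t'.1.1 ≤ t.1.2) (fun t => t.2.1) ?_ ⟨(_, c₀), hc₀⟩ ?_
  · rintro ⟨⟨t, c⟩, hc, hcb⟩ b hb hb0
    obtain ⟨t', ht', hle⟩ := hcb b hb hb0
    obtain ⟨c', hc', hc''⟩ := hdense t'
    exact ⟨⟨(t', c'), hc''⟩, ⟨ht', hle.trans hb⟩, hc'.trans hle⟩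
  · intro t _ ht h
    exact P.chain _ (fun n => (ht n).1) (le_bot_iff.1 ((le_iInf fun n =>
      (iInf_le _ (n + 1)).trans (ht n).2).trans h.le))

end CutChoose
theorem mainTheorem6 :
    (∃ (S : Set (Set.Iio (ω_ 1 : Ordinal.{0})))
      (f : CutChoose.CountableTree → CutChoose.CountableTree),
      IsStationary S ∧ IsStationary Sᶜ ∧ CutChoose.IsMandatoryExtension f) ∧
    ∀ (S : Set (Set.Iio (ω_ 1 : Ordinal.{0})))
      (f : CutChoose.CountableTree → CutChoose.CountableTree),
      IsStationary S → IsStationary Sᶜ → CutChoose.IsMandatoryExtension f →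
      CutChoose.IsSigmaClosed (CutChoose.TreeForcing S f) ∧
      CutChoose.souslinValue (CutChoose.TreeForcing.genericMem S f)
        (CutChoose.TreeForcing.genericLt S f) = ⊤ ∧
      CutChoose.IsProper (CutChoose.RO (CutChoose.MandatoryIteration S f)) ∧
      CutChoose.IsAleph0Distributive (CutChoose.RO (CutChoose.MandatoryIteration S f)) ∧
      CutChoose.density (CutChoose.RO (CutChoose.MandatoryIteration S f)) = 𝔠 ∧
      ¬ CutChoose.IIWinsDescending (CutChoose.RO (CutChoose.MandatoryIteration S f)) ∧
      ¬ CutChoose.IIWinsCutChoose (CutChoose.RO (CutChoose.MandatoryIteration S f)) := by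
  constructor
  · obtain ⟨S, hS, hSc⟩ := CutChoose.exists_isStationary_compl
    obtain ⟨f, hf⟩ := CutChoose.exists_isMandatoryExtension
    exact ⟨S, f, hS, hSc, hf⟩
  · intro S f hS hSc hf
    have H := CutChoose.PairCond.isDensePresentation S f
    exact ⟨CutChoose.TreeForcing.isSigmaClosed S f,
      CutChoose.TreeForcing.souslinValue_eq_top hf hSc,
      CutChoose.PairCond.isProper H hf hSc,
      CutChoose.PairCond.isAleph0Distributive H hf hSc,
      CutChoose.PairCond.density_eq H hf hSc,
      CutChoose.PairCond.not_iiWinsDescending H hf hS hSc,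
      CutChoose.PairCond.not_iiWinsCutChoose H hf hS hSc⟩
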